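/- Let $C$ be a set of colours and let $\Sigma$ be a $C$-sorted monoidal signature: a set of operations $o\colon w\to v$ with $w,v\in C^\star$ words over $C$. A *$C$-coloured PROP* is a symmetric strict monoidal category with set of objects $C^\star$ and with concatenation of words as monoidal product on objects. Let $\mathbf{Syn}(C,\Sigma)$ be the free $C$-coloured PROP on $\Sigma$: its arrows $w\to v$ are the $\Sigma$-terms of that type (built from the operations, identities $id_w$ and symmetries $\sigma_{w,v}$ by sequential composition and by monoidal product $\oplus$) modulo the laws of symmetric strict monoidal categories. A *$(C,\Sigma)$-hypergraph* is a finite directed hypergraph in which every hyperedge has an ordered list of source nodes and an ordered list of target nodes, every node is labelled by a colour, and every hyperedge is labelled by an operation $o\colon w\to v$ such that its source nodes are labelled, in order, by $w$ and its target nodes by $v$. Homomorphisms preserve sources, targets and labels. A word $w\in C^\star$ is identified with the discrete hypergraph (no hyperedges) having one node for each letter, labelled by that letter. Let $\mathbf{Csp}(C,\Sigma)$ be the $C$-coloured PROP whose arrows $w\to v$ are the isomorphism classes of cospans $w\to G\leftarrow v$ of $(C,\Sigma)$-hypergraphs, with composition given by pushout and $\oplus$ given by coproduct. Let $[\![\cdot]\!]_C\colon\mathbf{Syn}(C,\Sigma)\to\mathbf{Csp}(C,\Sigma)$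 be the unique identity-on-objects symmetric strict monoidal functor that sends each operation $o\colon w\to v$ to the cospan $w\to G_o\leftarrow v$, where $G_o$ consists of one hyperedge labelled $o$ with pairwise distinct source and target nodes, and the legs enumerate its sources and its targets respectively. For a node $x$ of a hypergraph, its *in-degree* is the number of pairs $(h,i)$ such that $x$ is the $i$-th target of the hyperedge $h$, and its *out-degree* is the number of pairs $(h,j)$ such that $x$ is the $j$-th source of $h$. A cospan $w\xrightarrow{f}G\xleftarrow{g}v$ is *monogamous* if $f$ and $g$ are mono and every node $x$ of $G$ has in-degree $0$ if $x$ is in the image of $f$ and $1$ otherwise, and out-degree $0$ if $x$ is in the image of $g$ and $1$ otherwise. It is *acyclic* if there are no node $x$ of $G$ and no sequence of hyperedges $h_1,\dots,h_n$ ($n\ge 1$) of $G$ such that $x$ is a source of $h_1$, some target of $h_i$ is a source of $h_{i+1}$ for every $i<n$, and $x$ is a target of $h_n$. **Proposition.** For all words $w,v\in C^\star$, a cospan $w\to G\leftarrow v$ of $(C,\Sigma)$-hypergraphs is (up to isomorphism of cospans) in the image of $[\![\cdot]\!]_C\colon\mathbf{Syn}(C,\Sigma)\to\mathbf{Csp}(C,\Sigma)$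 if and only if it is monogamous and acyclic. -/

import Mathlib

open CategoryTheory

namespace StringDiagram

universe u v x y

/-! ## Coloured PROPs and the free coloured PROP on a signature -/

/-- A multi-sorted monoidal signature: operations `o : dom o → cod o` between words of colours. -/
structure Signature (C : Type u) where
  Op : Type v
  dom : Op → List C
  cod : Op → List C

/-- Transport of an arrow along equalities of words. -/
def castHom {C : Type u} {H : List C → List C → Type x} {a a' b b' : List C}
    (ha : a = a') (hb : b = b') (f : H a b) : H a' b' :=
  cast (congrArg₂ H ha hb) f

/-- A `C`-coloured PROP: a symmetric strict monoidal category whose objects are the words over `C`,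
with concatenation as monoidal product on objects. Composition is in diagrammatic order; strictness
laws hold up to transport along equalities of words. -/
structure ColouredPROP (C : Type u) where
  Hom : List C → List C → Type x
  id : ∀ a, Hom a a
  comp : ∀ {a b c}, Hom a b → Hom b c → Hom a c
  tensor : ∀ {a b c d}, Hom a b → Hom c d → Hom (a ++ c) (b ++ d)
  symm : ∀ a b, Hom (a ++ b) (b ++ a)
  comp_assoc : ∀ {a b c d} (s : Hom a b) (t : Hom b c) (r : Hom c d),
    comp (comp s t) r = comp s (comp t r)
  id_comp : ∀ {a b} (s : Hom a b), comp (id a) s = s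
  comp_id : ∀ {a b} (s : Hom a b), comp s (id b) = s
  tensor_assoc : ∀ {a b c d e f} (s : Hom a b) (t : Hom c d) (r : Hom e f),
    castHom (List.append_assoc a c e) (List.append_assoc b d f) (tensor (tensor s t) r) =
      tensor s (tensor t r)
  id_nil_tensor : ∀ {a b} (s : Hom a b),
    castHom (List.nil_append a) (List.nil_append b) (tensor (id []) s) = s
  tensor_id_nil : ∀ {a b} (s : Hom a b),
    castHom (List.append_nil a) (List.append_nil b) (tensor s (id [])) = s
  interchange : ∀ {a b c a' b' c'} (s : Hom a b) (r : Hom b c) (t : Hom a' b') (q : Hom b' c'),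
    tensor (comp s r) (comp t q) = comp (tensor s t) (tensor r q)
  id_tensor_id : ∀ a b, tensor (id a) (id b) = id (a ++ b)
  hexagon : ∀ a b c,
    comp (castHom (List.append_assoc a b c) (List.append_assoc b a c) (tensor (symm a b) (id c)))
        (tensor (id b) (symm a c)) =
      castHom rfl (List.append_assoc b c a) (symm a (b ++ c))
  symm_symm : ∀ a b, comp (symm a b) (symm b a) = id (a ++ b)
  symm_natural : ∀ {a b} (s : Hom a b) (c : List C),
    comp (tensor s (id c)) (symm b c) = comp (symm a c) (tensor (id c) s)

/-- A morphism of `C`-coloured PROPs: a strict symmetric monoidal functor that is the identity on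
words. -/
structure ColouredPROP.Morphism {C : Type u} (P : ColouredPROP.{u, x} C)
    (Q : ColouredPROP.{u, y} C) where
  map : ∀ {a b}, P.Hom a b → Q.Hom a b
  map_id : ∀ a, map (P.id a) = Q.id a
  map_comp : ∀ {a b c} (s : P.Hom a b) (t : P.Hom b c), map (P.comp s t) = Q.comp (map s) (map t)
  map_tensor : ∀ {a b c d} (s : P.Hom a b) (t : P.Hom c d),
    map (P.tensor s t) = Q.tensor (map s) (map t)
  map_symm : ∀ a b, map (P.symm a b) = Q.symm a b

/-- `Σ`-terms: formal composites of operations, identities and symmetries. -/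
inductive Term {C : Type u} (S : Signature.{u, v} C) : List C → List C → Type (max u v)
  | op (o : S.Op) : Term S (S.dom o) (S.cod o)
  | id (a : List C) : Term S a a
  | symm (a b : List C) : Term S (a ++ b) (b ++ a)
  | comp {a b c : List C} : Term S a b → Term S b c → Term S a c
  | tensor {a b c d : List C} : Term S a b → Term S c d → Term S (a ++ c) (b ++ d)

/-- The smallest congruence on `Σ`-terms containing the laws of symmetric strict monoidal
categories. -/
inductive Term.Equiv {C : Type u} {S : Signature.{u, v} C} :
    ∀ {a b : List C}, Term S a b → Term S a b → Prop
  | refl {a b} (s : Term S a b) : Equiv s s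
  | symm' {a b} {s t : Term S a b} : Equiv s t → Equiv t s
  | trans {a b} {s t r : Term S a b} : Equiv s t → Equiv t r → Equiv s r
  | comp_congr {a b c} {s s' : Term S a b} {t t' : Term S b c} :
      Equiv s s' → Equiv t t' → Equiv (.comp s t) (.comp s' t')
  | tensor_congr {a b c d} {s s' : Term S a b} {t t' : Term S c d} :
      Equiv s s' → Equiv t t' → Equiv (.tensor s t) (.tensor s' t')
  | comp_assoc {a b c d} (s : Term S a b) (t : Term S b c) (r : Term S c d) :
      Equiv (.comp (.comp s t) r) (.comp s (.comp t r))
  | id_comp {a b} (s : Term S a b) : Equiv (.comp (.id a) s) s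
  | comp_id {a b} (s : Term S a b) : Equiv (.comp s (.id b)) s
  | tensor_assoc {a b c d e f} (s : Term S a b) (t : Term S c d) (r : Term S e f) :
      Equiv (castHom (List.append_assoc a c e) (List.append_assoc b d f)
        (.tensor (.tensor s t) r)) (.tensor s (.tensor t r))
  | id_nil_tensor {a b} (s : Term S a b) :
      Equiv (castHom (List.nil_append a) (List.nil_append b) (.tensor (.id []) s)) s
  | tensor_id_nil {a b} (s : Term S a b) :
      Equiv (castHom (List.append_nil a) (List.append_nil b) (.tensor s (.id []))) s
  | interchange {a b c a' b' c'} (s : Term S a b) (r : Term S b c) (t : Term S a' b')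
      (q : Term S b' c') :
      Equiv (.tensor (.comp s r) (.comp t q)) (.comp (.tensor s t) (.tensor r q))
  | id_tensor_id (a b) : Equiv (.tensor (.id a) (.id b)) (.id (a ++ b))
  | hexagon (a b c) :
      Equiv (.comp (castHom (List.append_assoc a b c) (List.append_assoc b a c)
          (.tensor (.symm a b) (.id c))) (.tensor (.id b) (.symm a c)))
        (castHom rfl (List.append_assoc b c a) (.symm a (b ++ c)))
  | symm_symm (a b) : Equiv (.comp (.symm a b) (.symm b a)) (.id (a ++ b))
  | symm_natural {a b} (s : Term S a b) (c : List C) :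
      Equiv (.comp (.tensor s (.id c)) (.symm b c)) (.comp (.symm a c) (.tensor (.id c) s))

def Term.setoid {C : Type u} (S : Signature.{u, v} C) (a b : List C) : Setoid (Term S a b) :=
  ⟨Term.Equiv, ⟨.refl, .symm', .trans⟩⟩

theorem castHom_mk {C : Type u} {H : List C → List C → Type x} (r : ∀ a b, Setoid (H a b))
    {a a' b b' : List C} (ha : a = a') (hb : b = b') (f : H a b) :
    castHom (H := fun a b => Quotient (r a b)) ha hb (Quotient.mk _ f) =
      Quotient.mk _ (castHom ha hb f) := by
  subst ha hb; rfl

/-- The free `C`-coloured PROP `Syn(C, Σ)`: `Σ`-terms modulo the laws of symmetric strict monoidal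
categories. -/
def Syn {C : Type u} (S : Signature.{u, v} C) : ColouredPROP.{u, max u v} C where
  Hom a b := Quotient (Term.setoid S a b)
  id a := Quotient.mk _ (.id a)
  comp := Quotient.map₂ .comp (fun _ _ h _ _ h' => .comp_congr h h')
  tensor := Quotient.map₂ .tensor (fun _ _ h _ _ h' => .tensor_congr h h')
  symm a b := Quotient.mk _ (.symm a b)
  comp_assoc := by rintro _ _ _ _ ⟨s⟩ ⟨t⟩ ⟨r⟩; exact Quotient.sound (.comp_assoc s t r)
  id_comp := by rintro _ _ ⟨s⟩; exact Quotient.sound (.id_comp s)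
  comp_id := by rintro _ _ ⟨s⟩; exact Quotient.sound (.comp_id s)
  tensor_assoc := by
    rintro _ _ _ _ _ _ ⟨s⟩ ⟨t⟩ ⟨r⟩
    exact (castHom_mk _ _ _ _).trans (Quotient.sound (.tensor_assoc s t r))
  id_nil_tensor := by
    rintro _ _ ⟨s⟩; exact (castHom_mk _ _ _ _).trans (Quotient.sound (.id_nil_tensor s))
  tensor_id_nil := by
    rintro _ _ ⟨s⟩; exact (castHom_mk _ _ _ _).trans (Quotient.sound (.tensor_id_nil s))
  interchange := by
    rintro _ _ _ _ _ _ ⟨s⟩ ⟨r⟩ ⟨t⟩ ⟨q⟩; exact Quotient.sound (.interchange s r t q)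
  id_tensor_id a b := Quotient.sound (.id_tensor_id a b)
  hexagon a b c := by
    refine Eq.trans ?_ ((Quotient.sound (Term.Equiv.hexagon a b c)).trans
      (castHom_mk (Term.setoid S) _ _ _).symm)
    exact congrArg (fun z => Quotient.map₂ Term.comp
      (fun _ _ h _ _ h' => Term.Equiv.comp_congr h h') z
      (Quotient.mk (Term.setoid S _ _) (Term.tensor (Term.id b) (Term.symm a c))))
      (castHom_mk (Term.setoid S) _ _ _)
  symm_symm a b := Quotient.sound (.symm_symm a b)
  symm_natural := by rintro _ _ ⟨s⟩ c; exact Quotient.sound (.symm_natural s c)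

/-- The value of a term in a coloured PROP, given values of the operations. -/
def Term.eval {C : Type u} {S : Signature.{u, v} C} (P : ColouredPROP.{u, x} C)
    (g : ∀ o : S.Op, P.Hom (S.dom o) (S.cod o)) : ∀ {a b : List C}, Term S a b → P.Hom a b
  | _, _, .op o => g o
  | _, _, .id a => P.id a
  | _, _, .symm a b => P.symm a b
  | _, _, .comp s t => P.comp (s.eval P g) (t.eval P g)
  | _, _, .tensor s t => P.tensor (s.eval P g) (t.eval P g)

theorem Term.eval_castHom {C : Type u} {S : Signature.{u, v} C} (P : ColouredPROP.{u, x} C)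
    (g : ∀ o : S.Op, P.Hom (S.dom o) (S.cod o)) {a a' b b' : List C} (ha : a = a') (hb : b = b')
    (s : Term S a b) : (castHom ha hb s : Term S a' b').eval P g = castHom ha hb (s.eval P g) := by
  subst ha hb; rfl

theorem Term.Equiv.eval_eq {C : Type u} {S : Signature.{u, v} C} (P : ColouredPROP.{u, x} C)
    (g : ∀ o : S.Op, P.Hom (S.dom o) (S.cod o)) {a b : List C} {s t : Term S a b}
    (h : Term.Equiv s t) : s.eval P g = t.eval P g := by
  induction h with
  | refl => rfl
  | symm' _ ih => exact ih.symm
  | trans _ _ ih ih' => exact ih.trans ih'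
  | comp_congr _ _ ih ih' => simp only [Term.eval, ih, ih']
  | tensor_congr _ _ ih ih' => simp only [Term.eval, ih, ih']
  | comp_assoc => exact P.comp_assoc _ _ _
  | id_comp => exact P.id_comp _
  | comp_id => exact P.comp_id _
  | tensor_assoc => rw [Term.eval_castHom]; exact P.tensor_assoc _ _ _
  | id_nil_tensor => rw [Term.eval_castHom]; exact P.id_nil_tensor _
  | tensor_id_nil => rw [Term.eval_castHom]; exact P.tensor_id_nil _
  | interchange => exact P.interchange _ _ _ _
  | id_tensor_id => exact P.id_tensor_id _ _
  | hexagon => simp only [Term.eval, Term.eval_castHom]; exact P.hexagon _ _ _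
  | symm_symm => exact P.symm_symm _ _
  | symm_natural => exact P.symm_natural _ _

/-- The morphism of coloured PROPs out of `Syn(C, Σ)` determined by the values of the operations. -/
def Syn.lift {C : Type u} {S : Signature.{u, v} C} (P : ColouredPROP.{u, x} C)
    (g : ∀ o : S.Op, P.Hom (S.dom o) (S.cod o)) : (Syn S).Morphism P where
  map := Quotient.lift (fun s => s.eval P g) (fun _ _ h => Term.Equiv.eval_eq P g h)
  map_id _ := rfl
  map_comp := by rintro _ _ _ ⟨s⟩ ⟨t⟩; rfl
  map_tensor := by rintro _ _ _ _ ⟨s⟩ ⟨t⟩; rfl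
  map_symm _ _ := rfl

/-! ## Hypergraphs -/

set_option linter.checkUnivs false in
/-- A directed hypergraph: each hyperedge has an ordered list of sources and of targets. -/
structure DirHypergraph where
  Node : Type x
  Edge : Type y
  src : Edge → List Node
  tgt : Edge → List Node

/-- Hypergraph homomorphisms. -/
structure DirHypergraph.Hom (G : DirHypergraph.{x, y}) (H : DirHypergraph.{u, v}) where
  node : G.Node → H.Node
  edge : G.Edge → H.Edge
  src_edge : ∀ e, H.src (edge e) = (G.src e).map node
  tgt_edge : ∀ e, H.tgt (edge e) = (G.tgt e).map node

/-- The hypergraph `G_{C,Σ}` of a signature: nodes are colours, hyperedges are operations. -/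
def Signature.graph {C : Type u} (S : Signature.{u, v} C) : DirHypergraph.{u, v} :=
  ⟨C, S.Op, S.dom, S.cod⟩

/-- Objects of `Hyp_{C,Σ}`: finite hypergraphs (finitely many nodes, and finitely many hyperedges
with `k` sources and `l` targets for each `k`, `l`) with a homomorphism to `G_{C,Σ}`. -/
structure LHyp {C : Type u} (S : Signature.{u, v} C) extends DirHypergraph.{0, 0} where
  finite_node : Finite Node
  finite_edge : ∀ k l : ℕ, {e : Edge | (src e).length = k ∧ (tgt e).length = l}.Finite
  label : DirHypergraph.Hom toDirHypergraph S.graph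

namespace LHyp

variable {C : Type u} {S : Signature.{u, v} C}

/-- Morphisms of `Hyp_{C,Σ}`: homomorphisms commuting with the labellings. -/
structure Hom (G H : LHyp S) extends DirHypergraph.Hom G.toDirHypergraph H.toDirHypergraph where
  label_node : ∀ z, H.label.node (node z) = G.label.node z
  label_edge : ∀ e, H.label.edge (edge e) = G.label.edge e

instance : Category (LHyp S) where
  Hom := Hom
  id G := ⟨⟨id, id, by simp, by simp⟩, by simp, by simp⟩
  comp f g := ⟨⟨g.node ∘ f.node, g.edge ∘ f.edge, by simp [f.src_edge, g.src_edge],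
    by simp [f.tgt_edge, g.tgt_edge]⟩, by simp [f.label_node, g.label_node],
    by simp [f.label_edge, g.label_edge]⟩

theorem hom_ext {G H : LHyp S} {f g : G ⟶ H} (hn : ∀ z, f.node z = g.node z)
    (he : ∀ e, f.edge e = g.edge e) : f = g := by
  obtain ⟨⟨fn, fe, _, _⟩, _, _⟩ := f
  obtain ⟨⟨gn, ge, _, _⟩, _, _⟩ := g
  obtain rfl : fn = gn := funext hn
  obtain rfl : fe = ge := funext he
  rfl

@[simp] theorem id_node {G : LHyp S} (z : G.Node) : (𝟙 G : G ⟶ G).node z = z := rfl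
@[simp] theorem id_edge {G : LHyp S} (e : G.Edge) : (𝟙 G : G ⟶ G).edge e = e := rfl
@[simp] theorem comp_node {G H K : LHyp S} (f : G ⟶ H) (g : H ⟶ K) (z : G.Node) :
    (f ≫ g).node z = g.node (f.node z) := rfl
@[simp] theorem comp_edge {G H K : LHyp S} (f : G ⟶ H) (g : H ⟶ K) (e : G.Edge) :
    (f ≫ g).edge e = g.edge (f.edge e) := rfl

/-- The discrete hypergraph on a word: one node for each letter, labelled by that letter. -/
def disc (S : Signature.{u, v} C) (w : List C) : LHyp S where
  Node := Fin w.length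
  Edge := Empty
  src := Empty.elim
  tgt := Empty.elim
  finite_node := inferInstance
  finite_edge _ _ := Set.toFinite _
  label := ⟨w.get, Empty.elim, fun e => e.elim, fun e => e.elim⟩

/-- A morphism out of a discrete hypergraph is a label-preserving map on nodes. -/
def ofDisc {w : List C} {G : LHyp S} (f : Fin w.length → G.Node)
    (hf : ∀ i, G.label.node (f i) = w.get i) : disc S w ⟶ G :=
  ⟨⟨f, Empty.elim, fun e => e.elim, fun e => e.elim⟩, hf, fun e => e.elim⟩

theorem disc_ext {w : List C} {G : LHyp S} {f g : disc S w ⟶ G}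
    (h : ∀ i : Fin w.length, f.node i = g.node i) : f = g :=
  hom_ext h (fun e => e.elim)

/-- The coproduct (disjoint union) of two labelled hypergraphs. -/
def sum (G H : LHyp S) : LHyp S where
  Node := G.Node ⊕ H.Node
  Edge := G.Edge ⊕ H.Edge
  src := Sum.elim (fun e => (G.src e).map Sum.inl) (fun e => (H.src e).map Sum.inr)
  tgt := Sum.elim (fun e => (G.tgt e).map Sum.inl) (fun e => (H.tgt e).map Sum.inr)
  finite_node := by
    have := G.finite_node; have := H.finite_node
    infer_instance
  finite_edge k l := by
    refine (((G.finite_edge k l).image Sum.inl).union ((H.finite_edge k l).image Sum.inr)).subset ?_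
    rintro (e | e) h <;> simpa using h
  label := ⟨Sum.elim G.label.node H.label.node, Sum.elim G.label.edge H.label.edge,
    by rintro (e | e) <;> simp [DirHypergraph.Hom.src_edge],
    by rintro (e | e) <;> simp [DirHypergraph.Hom.tgt_edge]⟩

def inl (G H : LHyp S) : G ⟶ sum G H :=
  ⟨⟨Sum.inl, Sum.inl, fun _ => rfl, fun _ => rfl⟩, fun _ => rfl, fun _ => rfl⟩

def inr (G H : LHyp S) : H ⟶ sum G H :=
  ⟨⟨Sum.inr, Sum.inr, fun _ => rfl, fun _ => rfl⟩, fun _ => rfl, fun _ => rfl⟩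

def desc {G H K : LHyp S} (f : G ⟶ K) (g : H ⟶ K) : sum G H ⟶ K :=
  ⟨⟨Sum.elim f.node g.node, Sum.elim f.edge g.edge,
    by rintro (e | e) <;> simp [sum, f.src_edge, g.src_edge],
    by rintro (e | e) <;> simp [sum, f.tgt_edge, g.tgt_edge]⟩,
    by rintro (z | z) <;> simp [sum, f.label_node, g.label_node],
    by rintro (e | e) <;> simp [sum, f.label_edge, g.label_edge]⟩

@[simp] theorem inl_desc {G H K : LHyp S} (f : G ⟶ K) (g : H ⟶ K) : inl G H ≫ desc f g = f := rfl
@[simp] theorem inr_desc {G H K : LHyp S} (f : G ⟶ K) (g : H ⟶ K) : inr G H ≫ desc f g = g := rfl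
@[simp] theorem inl_desc_assoc {G H K L : LHyp S} (f : G ⟶ K) (g : H ⟶ K) (k : K ⟶ L) :
    inl G H ≫ desc f g ≫ k = f ≫ k := rfl
@[simp] theorem inr_desc_assoc {G H K L : LHyp S} (f : G ⟶ K) (g : H ⟶ K) (k : K ⟶ L) :
    inr G H ≫ desc f g ≫ k = g ≫ k := rfl

theorem sum_ext {G H K : LHyp S} {f g : sum G H ⟶ K} (hl : inl G H ≫ f = inl G H ≫ g)
    (hr : inr G H ≫ f = inr G H ≫ g) : f = g := by
  refine hom_ext ?_ ?_
  · rintro (z | z)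
    · exact congrArg (fun k : G ⟶ K => k.node z) hl
    · exact congrArg (fun k : H ⟶ K => k.node z) hr
  · rintro (z | z)
    · exact congrArg (fun k : G ⟶ K => k.edge z) hl
    · exact congrArg (fun k : H ⟶ K => k.edge z) hr

/-- The two halves of the discrete hypergraph on a concatenation of words. -/
def discL (S : Signature.{u, v} C) (a b : List C) : disc S a ⟶ disc S (a ++ b) :=
  ofDisc (fun i => ⟨i.1, by simp; omega⟩)
    (fun i => List.getElem_append_left i.2)

def discR (S : Signature.{u, v} C) (a b : List C) : disc S b ⟶ disc S (a ++ b) :=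
  ofDisc (fun i => ⟨a.length + i.1, by simp⟩)
    (fun i => show (a ++ b)[a.length + i.1]'(by simp) = b[i.1] by simp)

/-- Copairing of morphisms out of discrete hypergraphs, `disc (a ++ b)` being the coproduct of
`disc a` and `disc b`. -/
def discDesc {a b : List C} {G : LHyp S} (f : disc S a ⟶ G) (g : disc S b ⟶ G) :
    disc S (a ++ b) ⟶ G :=
  ofDisc (fun i => if h : i.1 < a.length then f.node (⟨i.1, h⟩ : Fin a.length)
      else g.node (⟨i.1 - a.length, by have := i.2; simp at this; omega⟩ : Fin b.length))
    (fun i => by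
      have hi := i.2
      simp only [List.length_append] at hi
      by_cases h : i.1 < a.length
      · rw [dif_pos h]
        exact (f.label_node _).trans (List.getElem_append_left h).symm
      · rw [dif_neg h]
        exact (g.label_node _).trans (List.getElem_append_right (not_lt.1 h)).symm)

@[simp] theorem discL_discDesc {a b : List C} {G : LHyp S} (f : disc S a ⟶ G) (g : disc S b ⟶ G) :
    discL S a b ≫ discDesc f g = f :=
  disc_ext (fun i => dif_pos i.2)

@[simp] theorem discR_discDesc {a b : List C} {G : LHyp S} (f : disc S a ⟶ G) (g : disc S b ⟶ G) :
    discR S a b ≫ discDesc f g = g :=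
  disc_ext (fun i => (dif_neg (by simp [discR, ofDisc])).trans
    (congrArg g.node (Fin.ext (Nat.add_sub_cancel_left ..))))

@[simp] theorem discL_discDesc_assoc {a b : List C} {G H : LHyp S} (f : disc S a ⟶ G)
    (g : disc S b ⟶ G) (k : G ⟶ H) : discL S a b ≫ discDesc f g ≫ k = f ≫ k := by
  rw [← Category.assoc, discL_discDesc]

@[simp] theorem discR_discDesc_assoc {a b : List C} {G H : LHyp S} (f : disc S a ⟶ G)
    (g : disc S b ⟶ G) (k : G ⟶ H) : discR S a b ≫ discDesc f g ≫ k = g ≫ k := by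
  rw [← Category.assoc, discR_discDesc]

theorem discAppend_ext {a b : List C} {G : LHyp S} {f g : disc S (a ++ b) ⟶ G}
    (hl : discL S a b ≫ f = discL S a b ≫ g) (hr : discR S a b ≫ f = discR S a b ≫ g) :
    f = g := by
  refine disc_ext (fun i => ?_)
  have hi := i.2
  simp only [List.length_append] at hi
  by_cases h : i.1 < a.length
  · exact congrArg (fun k : disc S a ⟶ G => k.node (⟨i.1, h⟩ : Fin a.length)) hl
  · have := congrArg (fun k : disc S b ⟶ G =>
      k.node (⟨i.1 - a.length, by omega⟩ : Fin b.length)) hr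
    have e : (discR S a b).node (⟨i.1 - a.length, by omega⟩ : Fin b.length) = i :=
      Fin.ext (show a.length + (i.1 - a.length) = i.1 by omega)
    exact (congrArg f.node e).symm.trans (this.trans (congrArg g.node e))

theorem map_factor {α : Type u} {β : Type v} {γ : Type x} {p : α → β} {q : β → γ} {r : α → γ}
    (h : ∀ z, q (p z) = r z) (l : List α) : l.map r = (l.map p).map q := by
  simp [← h]

/-- Gluing two hypergraphs along a discrete one: the pushout of `f` and `g`. -/
def glue {w : List C} {G H : LHyp S} (f : disc S w ⟶ G) (g : disc S w ⟶ H) : LHyp S where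
  Node := Quot (fun p q : (sum G H).Node =>
    ∃ i : Fin w.length, p = Sum.inl (f.node i) ∧ q = Sum.inr (g.node i))
  Edge := (sum G H).Edge
  src e := ((sum G H).src e).map (Quot.mk _)
  tgt e := ((sum G H).tgt e).map (Quot.mk _)
  finite_node := by
    have := (sum G H).finite_node
    exact Finite.of_surjective (Quot.mk _) Quot.mk_surjective
  finite_edge k l := by
    simp only [List.length_map]
    exact (sum G H).finite_edge k l
  label := ⟨Quot.lift (sum G H).label.node (by
      rintro _ _ ⟨i, rfl, rfl⟩
      exact (f.label_node i).trans (g.label_node i).symm), (sum G H).label.edge,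
    fun e => ((sum G H).label.src_edge e).trans
      (map_factor (p := Quot.mk _) (q := Quot.lift _ _) (fun _ => rfl) _),
    fun e => ((sum G H).label.tgt_edge e).trans
      (map_factor (p := Quot.mk _) (q := Quot.lift _ _) (fun _ => rfl) _)⟩

def glueMk {w : List C} {G H : LHyp S} (f : disc S w ⟶ G) (g : disc S w ⟶ H) :
    sum G H ⟶ glue f g :=
  ⟨⟨Quot.mk _, _root_.id, fun _ => rfl, fun _ => rfl⟩, fun _ => rfl, fun _ => rfl⟩

def glueInl {w : List C} {G H : LHyp S} (f : disc S w ⟶ G) (g : disc S w ⟶ H) : G ⟶ glue f g :=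
  inl G H ≫ glueMk f g

def glueInr {w : List C} {G H : LHyp S} (f : disc S w ⟶ G) (g : disc S w ⟶ H) : H ⟶ glue f g :=
  inr G H ≫ glueMk f g

theorem glue_isPushout {w : List C} {G H : LHyp S} (f : disc S w ⟶ G) (g : disc S w ⟶ H) :
    IsPushout f g (glueInl f g) (glueInr f g) := by
  refine ⟨⟨disc_ext (fun i => Quot.sound ⟨i, rfl, rfl⟩)⟩,
    ⟨Limits.PushoutCocone.IsColimit.mk _ (fun s => ?_) (fun s => ?_) (fun s => ?_) ?_⟩⟩
  · exact ⟨⟨Quot.lift (desc s.inl s.inr).node (by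
      rintro _ _ ⟨i, rfl, rfl⟩
      exact congrArg (fun k : disc S w ⟶ s.pt => k.node i) s.condition), (desc s.inl s.inr).edge,
      fun e => ((desc s.inl s.inr).src_edge e).trans
        (map_factor (p := Quot.mk _) (q := Quot.lift _ _) (fun _ => rfl) _),
      fun e => ((desc s.inl s.inr).tgt_edge e).trans
        (map_factor (p := Quot.mk _) (q := Quot.lift _ _) (fun _ => rfl) _)⟩,
      fun z => by
        obtain ⟨z, rfl⟩ := Quot.mk_surjective z
        exact (desc s.inl s.inr).label_node z, (desc s.inl s.inr).label_edge⟩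
  · rfl
  · rfl
  · intro s m hl hr
    refine hom_ext (fun z => ?_) (fun e => ?_)
    · obtain ⟨z | z, rfl⟩ := Quot.mk_surjective z
      · exact congrArg (fun k : G ⟶ s.pt => k.node z) hl
      · exact congrArg (fun k : H ⟶ s.pt => k.node z) hr
    · obtain e | e := e
      · exact congrArg (fun k : G ⟶ s.pt => k.edge e) hl
      · exact congrArg (fun k : H ⟶ s.pt => k.edge e) hr

/-- The canonical isomorphism between the discrete hypergraphs on equal words. -/
def discCast (S : Signature.{u, v} C) {a b : List C} (h : a = b) : disc S a ⟶ disc S b :=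
  ofDisc (Fin.cast (congrArg List.length h)) (by subst h; intro i; rfl)

@[simp] theorem discCast_rfl (a : List C) : discCast S (rfl : a = a) = 𝟙 _ :=
  disc_ext (fun _ => rfl)

/-- The hypergraph consisting of a single hyperedge labelled by `o`, with pairwise distinct source
and target nodes. -/
def opGraph (S : Signature.{u, v} C) (o : S.Op) : LHyp S where
  Node := Fin (S.dom o).length ⊕ Fin (S.cod o).length
  Edge := Unit
  src _ := (List.finRange _).map Sum.inl
  tgt _ := (List.finRange _).map Sum.inr
  finite_node := inferInstance
  finite_edge _ _ := Set.toFinite _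
  label := ⟨Sum.elim (S.dom o).get (S.cod o).get, fun _ => o,
    fun _ => (List.map_get_finRange _).symm.trans (map_factor (p := Sum.inl)
      (q := Sum.elim (S.dom o).get (S.cod o).get) (fun _ => rfl) _),
    fun _ => (List.map_get_finRange _).symm.trans (map_factor (p := Sum.inr)
      (q := Sum.elim (S.dom o).get (S.cod o).get) (fun _ => rfl) _)⟩

end LHyp

open LHyp

/-- Cospans `w → G ← v` in `Hyp_{C,Σ}` between discrete hypergraphs. -/
structure Cospan {C : Type u} (S : Signature.{u, v} C) (w v : List C) where
  carrier : LHyp S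
  left : disc S w ⟶ carrier
  right : disc S v ⟶ carrier

namespace Cospan

variable {C : Type u} {S : Signature.{u, v} C}

/-- Isomorphism of cospans. -/
def setoid (S : Signature.{u, v} C) (a b : List C) : Setoid (Cospan S a b) where
  r c d := ∃ e : c.carrier ≅ d.carrier, c.left ≫ e.hom = d.left ∧ c.right ≫ e.hom = d.right
  iseqv := ⟨fun _ => ⟨Iso.refl _, by simp, by simp⟩,
    fun ⟨e, h, h'⟩ => ⟨e.symm, by simp [← h], by simp [← h']⟩,
    fun ⟨e, h, h'⟩ ⟨e', k, k'⟩ => ⟨e ≪≫ e', by simp [← h, ← k], by simp [← h', ← k']⟩⟩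

@[reducible] def id (S : Signature.{u, v} C) (a : List C) : Cospan S a a := ⟨disc S a, 𝟙 _, 𝟙 _⟩

/-- Composition by pushout. -/
@[reducible] def comp {a b c : List C} (s : Cospan S a b) (t : Cospan S b c) : Cospan S a c :=
  ⟨glue s.right t.left, s.left ≫ glueInl _ _, t.right ≫ glueInr _ _⟩

/-- Monoidal product by coproduct. -/
@[reducible] def tensor {a b c d : List C} (s : Cospan S a b) (t : Cospan S c d) :
    Cospan S (a ++ c) (b ++ d) :=
  ⟨sum s.carrier t.carrier, discDesc (s.left ≫ inl _ _) (t.left ≫ inr _ _),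
    discDesc (s.right ≫ inl _ _) (t.right ≫ inr _ _)⟩

@[reducible] def symm (S : Signature.{u, v} C) (a b : List C) : Cospan S (a ++ b) (b ++ a) :=
  ⟨disc S (a ++ b), 𝟙 _, discDesc (discR S a b) (discL S a b)⟩

/-- The cospan interpreting an operation: its single hyperedge, with the sources as inputs and the
targets as outputs. -/
def op (S : Signature.{u, v} C) (o : S.Op) : Cospan S (S.dom o) (S.cod o) :=
  ⟨opGraph S o, ofDisc Sum.inl (fun _ => rfl), ofDisc Sum.inr (fun _ => rfl)⟩

theorem castHom_eq {a a' b b' : List C} (ha : a = a') (hb : b = b') (s : Cospan S a b) :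
    castHom ha hb s =
      ⟨s.carrier, discCast S ha.symm ≫ s.left, discCast S hb.symm ≫ s.right⟩ := by
  subst ha hb
  simp [castHom]

theorem comp_equiv {a b c : List C} (s : Cospan S a b) (t : Cospan S b c) {P : LHyp S}
    {p : s.carrier ⟶ P} {q : t.carrier ⟶ P} (h : IsPushout s.right t.left p q) :
    setoid S a c (comp s t) ⟨P, s.left ≫ p, t.right ≫ q⟩ :=
  ⟨(glue_isPushout _ _).isoIsPushout _ _ h, by simp [comp], by simp [comp]⟩

theorem comp_congr {a b c : List C} {s s' : Cospan S a b} {t t' : Cospan S b c}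
    (h : setoid S a b s s') (h' : setoid S b c t t') :
    setoid S a c (comp s t) (comp s' t') := by
  obtain ⟨e, h₁, h₂⟩ := h
  obtain ⟨e', h₁', h₂'⟩ := h'
  have key := (glue_isPushout s'.right t'.left).of_iso (Iso.refl _) e.symm e'.symm (Iso.refl _)
    (f' := s.right) (g' := t.left) (inl' := e.hom ≫ glueInl _ _) (inr' := e'.hom ≫ glueInr _ _)
    (by simp [← h₂]) (by simp [← h₁']) (by simp) (by simp)
  refine (setoid S a c).trans (comp_equiv s t key) ⟨Iso.refl _, ?_, ?_⟩
  · simp [comp, ← h₁]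
  · simp [comp, ← h₂']

theorem tensor_congr {a b c d : List C} {s s' : Cospan S a b} {t t' : Cospan S c d}
    (h : setoid S a b s s') (h' : setoid S c d t t') :
    setoid S (a ++ c) (b ++ d) (tensor s t) (tensor s' t') := by
  obtain ⟨e, h₁, h₂⟩ := h
  obtain ⟨e', h₁', h₂'⟩ := h'
  refine ⟨⟨desc (e.hom ≫ inl _ _) (e'.hom ≫ inr _ _), desc (e.inv ≫ inl _ _) (e'.inv ≫ inr _ _),
    sum_ext (by simp) (by simp), sum_ext (by simp) (by simp)⟩,
    discAppend_ext ?_ ?_, discAppend_ext ?_ ?_⟩ <;> simp [tensor, ← h₁, ← h₂, ← h₁', ← h₂']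

theorem sum_isPushout {a b : List C} {G H P G' H' P' : LHyp S} {f : disc S a ⟶ G}
    {g : disc S a ⟶ H} {p : G ⟶ P} {q : H ⟶ P} {f' : disc S b ⟶ G'} {g' : disc S b ⟶ H'}
    {p' : G' ⟶ P'} {q' : H' ⟶ P'} (h : IsPushout f g p q) (h' : IsPushout f' g' p' q') :
    IsPushout (discDesc (f ≫ inl G G') (f' ≫ inr G G')) (discDesc (g ≫ inl H H') (g' ≫ inr H H'))
      (desc (p ≫ inl P P') (p' ≫ inr P P')) (desc (q ≫ inl P P') (q' ≫ inr P P')) := by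
  refine ⟨⟨discAppend_ext (by simp [h.w_assoc]) (by simp [h'.w_assoc])⟩,
    ⟨Limits.PushoutCocone.IsColimit.mk _
      (fun s => desc
        (h.desc (inl _ _ ≫ s.inl) (inl _ _ ≫ s.inr) ?_)
        (h'.desc (inr _ _ ≫ s.inl) (inr _ _ ≫ s.inr) ?_)) (fun s => ?_) (fun s => ?_) ?_⟩⟩
  · simpa using congrArg (fun k => discL S a b ≫ k) s.condition
  · simpa using congrArg (fun k => discR S a b ≫ k) s.condition
  · exact sum_ext (by simp) (by simp)
  · exact sum_ext (by simp) (by simp)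
  · intro s m hl hr
    refine sum_ext (h.hom_ext ?_ ?_) (h'.hom_ext ?_ ?_)
    · simp [← hl]
    · simp [← hr]
    · simp [← hl]
    · simp [← hr]

theorem comp_assoc {a b c d : List C} (s : Cospan S a b) (t : Cospan S b c) (r : Cospan S c d) :
    setoid S a d (comp (comp s t) r) (comp s (comp t r)) := by
  have big := (glue_isPushout (comp s t).right r.left).of_left' (glue_isPushout t.right r.left)
  have key := (glue_isPushout s.right t.left).paste_vert big
  refine (setoid S a d).trans ?_ ((setoid S a d).symm (comp_equiv s (comp t r) key))
  exact ⟨Iso.refl _, by simp [comp], by simp [comp]⟩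

theorem id_comp {a b : List C} (s : Cospan S a b) : setoid S a b (comp (id S a) s) s := by
  refine (setoid S a b).trans (comp_equiv (id S a) s IsPushout.of_id_fst) ?_
  exact ⟨Iso.refl _, by simp [id], by simp⟩

theorem comp_id {a b : List C} (s : Cospan S a b) : setoid S a b (comp s (id S b)) s := by
  refine (setoid S a b).trans (comp_equiv s (id S b) IsPushout.of_id_snd) ?_
  exact ⟨Iso.refl _, by simp, by simp [id]⟩

theorem discL_cast (a b c : List C) (h : a ++ (b ++ c) = a ++ b ++ c) :
    discL S a (b ++ c) ≫ discCast S h = discL S a b ≫ discL S (a ++ b) c :=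
  disc_ext (fun _ => rfl)

theorem discM_cast (a b c : List C) (h : a ++ (b ++ c) = a ++ b ++ c) :
    discL S b c ≫ discR S a (b ++ c) ≫ discCast S h = discR S a b ≫ discL S (a ++ b) c :=
  disc_ext (fun _ => rfl)

theorem discR_cast (a b c : List C) (h : a ++ (b ++ c) = a ++ b ++ c) :
    discR S b c ≫ discR S a (b ++ c) ≫ discCast S h = discR S (a ++ b) c :=
  disc_ext (fun i => Fin.ext (show a.length + (b.length + i.1) = (a ++ b).length + i.1 by
    simp [add_assoc]))

theorem discAppend₃_ext {a b c : List C} {G : LHyp S} {f g : disc S (a ++ (b ++ c)) ⟶ G}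
    (h₁ : discL S a (b ++ c) ≫ f = discL S a (b ++ c) ≫ g)
    (h₂ : discL S b c ≫ discR S a (b ++ c) ≫ f = discL S b c ≫ discR S a (b ++ c) ≫ g)
    (h₃ : discR S b c ≫ discR S a (b ++ c) ≫ f = discR S b c ≫ discR S a (b ++ c) ≫ g) : f = g :=
  discAppend_ext h₁ (discAppend_ext h₂ h₃)

theorem cast_discDesc (a b c : List C) (h : a ++ (b ++ c) = a ++ b ++ c) {G : LHyp S}
    (f : disc S a ⟶ G) (g : disc S b ⟶ G) (k : disc S c ⟶ G) :
    discCast S h ≫ discDesc (discDesc f g) k = discDesc f (discDesc g k) := by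
  apply discAppend₃_ext
  · rw [← Category.assoc, discL_cast]; simp
  · have := congrArg (fun z => z ≫ discDesc (discDesc f g) k) (discM_cast (S := S) a b c h)
    simpa using this
  · have := congrArg (fun z => z ≫ discDesc (discDesc f g) k) (discR_cast (S := S) a b c h)
    simpa using this

theorem discDesc_comp {a b : List C} {G H : LHyp S} (f : disc S a ⟶ G) (g : disc S b ⟶ G)
    (k : G ⟶ H) : discDesc f g ≫ k = discDesc (f ≫ k) (g ≫ k) :=
  discAppend_ext (by simp) (by simp)

theorem tensor_assoc {a b c d e f : List C} (s : Cospan S a b) (t : Cospan S c d)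
    (r : Cospan S e f) :
    setoid S _ _ (castHom (List.append_assoc a c e) (List.append_assoc b d f)
      (tensor (tensor s t) r)) (tensor s (tensor t r)) := by
  rw [castHom_eq]
  refine ⟨⟨desc (desc (inl _ _) (inl _ _ ≫ inr _ _)) (inr _ _ ≫ inr _ _),
    desc (inl _ _ ≫ inl _ _) (desc (inr _ _ ≫ inl _ _) (inr _ _)),
    sum_ext (sum_ext (by simp) (by simp)) (by simp),
    sum_ext (by simp) (sum_ext (by simp) (by simp))⟩, ?_, ?_⟩
  · simp only [tensor, discDesc_comp, Category.assoc, cast_discDesc, inl_desc, inr_desc]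
  · simp only [tensor, discDesc_comp, Category.assoc, cast_discDesc, inl_desc, inr_desc]

theorem disc_nil_ext {G : LHyp S} (f g : disc S [] ⟶ G) : f = g :=
  disc_ext (fun i => i.elim0)

def discNil (G : LHyp S) : disc S [] ⟶ G := ofDisc (fun i => i.elim0) (fun i => i.elim0)

theorem cast_nil_discDesc {a : List C} (h : a = [] ++ a) {G : LHyp S} (f : disc S [] ⟶ G)
    (g : disc S a ⟶ G) : discCast S h ≫ discDesc f g = g :=
  disc_ext (fun _ => congrArg g.node (Fin.ext (Nat.sub_zero _)))

theorem id_nil_tensor {a b : List C} (s : Cospan S a b) :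
    setoid S a b (castHom (List.nil_append a) (List.nil_append b) (tensor (id S []) s)) s := by
  rw [castHom_eq]
  refine ⟨⟨desc (discNil _) (𝟙 _), inr _ _, sum_ext (disc_nil_ext _ _) (by simp), by simp⟩,
    ?_, ?_⟩
  · simp only [tensor, Category.assoc, cast_nil_discDesc, inr_desc, Category.comp_id]
  · simp only [tensor, Category.assoc, cast_nil_discDesc, inr_desc, Category.comp_id]

theorem cast_discDesc_nil {a : List C} (h : a = a ++ []) {G : LHyp S} (f : disc S a ⟶ G)
    (g : disc S [] ⟶ G) : discCast S h ≫ discDesc f g = f :=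
  disc_ext (fun i => dif_pos i.2)

theorem tensor_id_nil {a b : List C} (s : Cospan S a b) :
    setoid S a b (castHom (List.append_nil a) (List.append_nil b) (tensor s (id S []))) s := by
  rw [castHom_eq]
  refine ⟨⟨desc (𝟙 _) (discNil _), inl _ _, sum_ext (by simp) (disc_nil_ext _ _), by simp⟩,
    ?_, ?_⟩
  · simp [tensor, cast_discDesc_nil]
  · simp [tensor, cast_discDesc_nil]

theorem interchange {a b c a' b' c' : List C} (s : Cospan S a b) (r : Cospan S b c)
    (t : Cospan S a' b') (q : Cospan S b' c') :
    setoid S _ _ (tensor (comp s r) (comp t q)) (comp (tensor s t) (tensor r q)) := by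
  refine (setoid S _ _).trans ?_ ((setoid S _ _).symm (comp_equiv (tensor s t) (tensor r q)
    (sum_isPushout (glue_isPushout s.right r.left) (glue_isPushout t.right q.left))))
  exact ⟨Iso.refl _, by simp [tensor, comp, discDesc_comp], by simp [tensor, comp, discDesc_comp]⟩

theorem id_tensor_id (a b : List C) : setoid S _ _ (tensor (id S a) (id S b)) (id S (a ++ b)) := by
  refine ⟨⟨desc (discL S a b) (discR S a b), discDesc (inl _ _) (inr _ _),
    sum_ext (by simp) (by simp), discAppend_ext (by simp) (by simp)⟩, ?_, ?_⟩
  · exact discAppend_ext (by simp [tensor, id]) (by simp [tensor, id])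
  · exact discAppend_ext (by simp [tensor, id]) (by simp [tensor, id])

def swap (S : Signature.{u, v} C) (a b : List C) : disc S (b ++ a) ≅ disc S (a ++ b) :=
  ⟨discDesc (discR S a b) (discL S a b), discDesc (discR S b a) (discL S b a),
    discAppend_ext (by simp) (by simp), discAppend_ext (by simp) (by simp)⟩

theorem comp_symm {x : List C} (a b : List C) (s : Cospan S x (a ++ b)) :
    setoid S _ _ (comp s (symm S a b)) ⟨s.carrier, s.left, (swap S a b).hom ≫ s.right⟩ := by
  refine (setoid S _ _).trans (comp_equiv s (symm S a b) IsPushout.of_id_snd) ?_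
  exact ⟨Iso.refl _, by simp, by simp [symm, swap]⟩

theorem symm_comp {x : List C} (a b : List C) (s : Cospan S (b ++ a) x) :
    setoid S _ _ (comp (symm S a b) s) ⟨s.carrier, (swap S b a).hom ≫ s.left, s.right⟩ := by
  have key : IsPushout (symm S a b).right s.left ((swap S b a).hom ≫ s.left) (𝟙 _) :=
    IsPushout.of_horiz_isIso (f := (swap S a b).hom) ⟨discAppend_ext
      (by simp [swap]) (by simp [swap])⟩
  refine (setoid S _ _).trans (comp_equiv (symm S a b) s key) ?_
  exact ⟨Iso.refl _, by simp [symm], by simp⟩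

theorem comp_perm {a b c : List C} (f : disc S b ⟶ disc S a) (g : disc S c ⟶ disc S b) :
    setoid S a c (comp ⟨disc S a, 𝟙 _, f⟩ ⟨disc S b, 𝟙 _, g⟩) ⟨disc S a, 𝟙 _, g ≫ f⟩ := by
  refine (setoid S a c).trans (comp_equiv _ _ IsPushout.of_id_snd) ?_
  exact ⟨Iso.refl _, by simp, by simp⟩

theorem hexagon (a b c : List C) :
    setoid S _ _
      (comp (castHom (List.append_assoc a b c) (List.append_assoc b a c)
        (tensor (symm S a b) (id S c))) (tensor (id S b) (symm S a c)))
      (castHom rfl (List.append_assoc b c a) (symm S a (b ++ c))) := by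
  rw [castHom_eq, castHom_eq]
  let β : disc S (b ++ (a ++ c)) ⟶ disc S (a ++ (b ++ c)) :=
    discDesc (discL S b c ≫ discR S a (b ++ c))
      (discDesc (discL S a (b ++ c)) (discR S b c ≫ discR S a (b ++ c)))
  let γ : disc S (b ++ (c ++ a)) ⟶ disc S (b ++ (a ++ c)) :=
    discDesc (discL S b (a ++ c))
      (discDesc (discR S a c ≫ discR S b (a ++ c)) (discL S a c ≫ discR S b (a ++ c)))
  refine (setoid S _ _).trans (comp_congr (s' := ⟨disc S (a ++ (b ++ c)), 𝟙 _, β⟩)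
    (t' := ⟨disc S (b ++ (a ++ c)), 𝟙 _, γ⟩) ?_ ?_) ((setoid S _ _).trans (comp_perm β γ) ?_)
  · refine ⟨⟨desc (discDesc (discL S a (b ++ c)) (discL S b c ≫ discR S a (b ++ c)))
      (discR S b c ≫ discR S a (b ++ c)),
      discDesc (discL S a b ≫ inl _ _) (discDesc (discR S a b ≫ inl _ _) (inr _ _)),
      sum_ext (discAppend_ext (by simp) (by simp)) (by simp),
      discAppend₃_ext (by simp) (by simp) (by simp)⟩, ?_, ?_⟩
    · simp only [Category.assoc, discDesc_comp, Category.id_comp, inl_desc, inr_desc,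
        cast_discDesc]
      exact discAppend₃_ext (by simp) (by simp) (by simp)
    · simp only [Category.assoc, discDesc_comp, Category.id_comp, inl_desc, inr_desc,
        discL_discDesc, discR_discDesc, cast_discDesc, β]
  · refine ⟨⟨desc (discL S b (a ++ c)) (discR S b (a ++ c)), discDesc (inl _ _) (inr _ _),
      sum_ext (by simp) (by simp), discAppend_ext (by simp) (by simp)⟩, ?_, ?_⟩
    · exact discAppend_ext (by simp) (by simp)
    · exact discAppend₃_ext (by simp [γ]) (by simp [γ]) (by simp [γ])
  · have e : discR S a (b ++ c) =
        discDesc (discL S b c ≫ discR S a (b ++ c)) (discR S b c ≫ discR S a (b ++ c)) :=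
      discAppend_ext (by simp) (by simp)
    refine ⟨Iso.refl _, by simp, ?_⟩
    simp only [symm]
    rw [e, cast_discDesc]
    exact discAppend₃_ext (by simp [γ, β]) (by simp [γ, β]) (by simp [γ, β])

theorem symm_symm (a b : List C) :
    setoid S _ _ (comp (symm S a b) (symm S b a)) (id S (a ++ b)) := by
  refine (setoid S _ _).trans (comp_symm b a (symm S a b)) ⟨Iso.refl _, by simp [symm, id], ?_⟩
  exact discAppend_ext (by simp [symm, id, swap]) (by simp [symm, id, swap])

theorem symm_natural {a b : List C} (s : Cospan S a b) (c : List C) :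
    setoid S _ _ (comp (tensor s (id S c)) (symm S b c))
      (comp (symm S a c) (tensor (id S c) s)) := by
  refine (setoid S _ _).trans (comp_symm b c _) ((setoid S _ _).trans ?_
    ((setoid S _ _).symm (symm_comp a c _)))
  refine ⟨⟨desc (inr _ _) (inl _ _), desc (inr _ _) (inl _ _),
    sum_ext (by simp) (by simp), sum_ext (by simp) (by simp)⟩, ?_, ?_⟩ <;>
  exact discAppend_ext (by simp [tensor, id, swap]) (by simp [tensor, id, swap])

end Cospan

/-- The `C`-coloured PROP of cospans of finite `(C, Σ)`-labelled hypergraphs between discrete ones,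
up to isomorphism. A discrete object is identified with the word of its labels. -/
def Csp {C : Type u} (S : Signature.{u, v} C) : ColouredPROP.{u, max 1 u v} C where
  Hom a b := Quotient (Cospan.setoid S a b)
  id a := Quotient.mk _ (Cospan.id S a)
  comp := Quotient.map₂ Cospan.comp (fun _ _ h _ _ h' => Cospan.comp_congr h h')
  tensor := Quotient.map₂ Cospan.tensor (fun _ _ h _ _ h' => Cospan.tensor_congr h h')
  symm a b := Quotient.mk _ (Cospan.symm S a b)
  comp_assoc := by rintro _ _ _ _ ⟨s⟩ ⟨t⟩ ⟨r⟩; exact Quotient.sound (Cospan.comp_assoc s t r)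
  id_comp := by rintro _ _ ⟨s⟩; exact Quotient.sound (Cospan.id_comp s)
  comp_id := by rintro _ _ ⟨s⟩; exact Quotient.sound (Cospan.comp_id s)
  tensor_assoc := by
    rintro _ _ _ _ _ _ ⟨s⟩ ⟨t⟩ ⟨r⟩
    exact (castHom_mk _ _ _ _).trans (Quotient.sound (Cospan.tensor_assoc s t r))
  id_nil_tensor := by
    rintro _ _ ⟨s⟩; exact (castHom_mk _ _ _ _).trans (Quotient.sound (Cospan.id_nil_tensor s))
  tensor_id_nil := by
    rintro _ _ ⟨s⟩; exact (castHom_mk _ _ _ _).trans (Quotient.sound (Cospan.tensor_id_nil s))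
  interchange := by
    rintro _ _ _ _ _ _ ⟨s⟩ ⟨r⟩ ⟨t⟩ ⟨q⟩; exact Quotient.sound (Cospan.interchange s r t q)
  id_tensor_id a b := Quotient.sound (Cospan.id_tensor_id a b)
  hexagon a b c := by
    refine Eq.trans ?_ ((Quotient.sound (Cospan.hexagon a b c)).trans
      (castHom_mk (Cospan.setoid S) _ _ _).symm)
    exact congrArg (fun z => Quotient.map₂ Cospan.comp
      (fun _ _ h _ _ h' => Cospan.comp_congr h h') z
      (Quotient.mk (Cospan.setoid S _ _) (Cospan.tensor (Cospan.id S b) (Cospan.symm S a c))))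
      (castHom_mk (Cospan.setoid S) _ _ _)
  symm_symm a b := Quotient.sound (Cospan.symm_symm a b)
  symm_natural := by rintro _ _ ⟨s⟩ c; exact Quotient.sound (Cospan.symm_natural s c)

/-- The arrow of `Csp` represented by a cospan. -/
def Cospan.toHom {C : Type u} {S : Signature.{u, v} C} {a b : List C} (s : Cospan S a b) :
    (Csp S).Hom a b :=
  Quotient.mk (Cospan.setoid S a b) s

/-- The interpretation `Syn(C, Σ) → Csp`: the morphism of coloured PROPs sending each operation to
the corresponding single-hyperedge cospan. -/
def interpretation {C : Type u} (S : Signature.{u, v} C) : (Syn S).Morphism (Csp S) :=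
  Syn.lift (Csp S) (fun o => (Cospan.op S o).toHom)

/-! ## Monogamy and acyclicity -/

namespace DirHypergraph

/-- The number of pairs `(h, i)` such that `z` is the `i`-th target of the hyperedge `h`. -/
noncomputable def inDegree (G : DirHypergraph.{x, y}) (z : G.Node) : ℕ∞ :=
  {p : G.Edge × ℕ | (G.tgt p.1)[p.2]? = some z}.encard

/-- The number of pairs `(h, j)` such that `z` is the `j`-th source of the hyperedge `h`. -/
noncomputable def outDegree (G : DirHypergraph.{x, y}) (z : G.Node) : ℕ∞ :=
  {p : G.Edge × ℕ | (G.src p.1)[p.2]? = some z}.encard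

/-- `h'` is a successor of `h`: some node is a target of `h` and a source of `h'`. -/
def IsSuccessor (G : DirHypergraph.{x, y}) (h h' : G.Edge) : Prop :=
  ∃ z, z ∈ G.tgt h ∧ z ∈ G.src h'

/-- A path `p = [h₁, …, hₙ]` of hyperedges from the node `z` to the node `z'`: each hyperedge is a
successor of the preceding one, `z` is a source of `h₁` and `z'` is a target of `hₙ`. -/
def IsPath (G : DirHypergraph.{x, y}) (p : List G.Edge) (z z' : G.Node) : Prop :=
  p.IsChain G.IsSuccessor ∧ (∃ h ∈ p.head?, z ∈ G.src h) ∧ (∃ h' ∈ p.getLast?, z' ∈ G.tgt h')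

/-- There is no path from a node to itself. -/
def Acyclic (G : DirHypergraph.{x, y}) : Prop :=
  ∀ (z : G.Node) (p : List G.Edge), ¬ G.IsPath p z z

end DirHypergraph

namespace Cospan

variable {C : Type u} {S : Signature.{u, v} C} {a b : List C}

/-- The nodes in the image of the left leg. -/
def inputs (s : Cospan S a b) : Set s.carrier.Node := Set.range s.left.node

/-- The nodes in the image of the right leg. -/
def outputs (s : Cospan S a b) : Set s.carrier.Node := Set.range s.right.node

open Classical in
/-- Both legs are mono; inputs have in-degree `0` and all other nodes in-degree `1`; outputs have
out-degree `0` and all other nodes out-degree `1`. -/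
def Monogamous (s : Cospan S a b) : Prop :=
  Mono s.left ∧ Mono s.right ∧ ∀ z : s.carrier.Node,
    s.carrier.inDegree z = (if z ∈ s.inputs then 0 else 1) ∧
    s.carrier.outDegree z = (if z ∈ s.outputs then 0 else 1)

/-- The carrier of the cospan is acyclic. -/
def Acyclic (s : Cospan S a b) : Prop :=
  s.carrier.toDirHypergraph.Acyclic

end Cospan
end StringDiagram

namespace StringDiagram

open LHyp

/-! Monogamy is a counting condition: in the inputs followed by the target lists of all hyperedges,
every node occurs exactly once, and likewise in the outputs followed by all source lists. This is
`Cospan.Linear`, and `monogamous_iff_linear` is the translation.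

Terms give such cospans by induction. For composition, a pushout along the interface replaces each
interface occurrence in one factor by the occurrence of the same node in the other factor
(`UniqueOcc.pushout`). Acyclicity is carried by a bounded rank on hyperedges, increasing along
successors; in a composite the ranks of the second factor are shifted above those of the first
(`Ranked.comp`).

Conversely, a linear cospan has finitely many hyperedges, so acyclicity lets them be sorted
topologically. Sweep through them while keeping a list of nodes, the frontier, which starts as the
inputs. The sources of the next hyperedge `e` all lie on the frontier: permute it to `src e ++ K`,
apply `e ⊕ id`, and continue from `tgt e ++ K`; at the end the frontier is a permutation of the
outputs (`Traced.of_topological_sort`). The resulting term comes with a homomorphism from its cospan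
to `G` that respects the legs and is bijective on hyperedges. Both cospans being linear, a node is
determined by the position where it occurs, so the homomorphism is also bijective on nodes
(`Linear.equiv_of_hom`). No decomposition of `G` itself is needed. -/

/-! ## Unique occurrences of nodes -/

section Occurrences

variable {A A' B N N' N₁ N₂ E E' E₁ E₂ : Type*}

/-- The node `z` occurs at the position `q`, either in the family `l` or in one of the lists
`T e`. -/
def Occurs (l : A → N) (T : E → List N) (q : A ⊕ E × ℕ) (z : N) : Prop :=
  Sum.elim (fun i => l i = z) (fun p => (T p.1)[p.2]? = some z) q

/-- Every node occurs at exactly one position of the family `l` and the lists `T e`. -/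
def UniqueOcc (l : A → N) (T : E → List N) : Prop :=
  ∀ z, ∃! q, Occurs l T q z

@[simp] theorem occurs_inl {l : A → N} {T : E → List N} {i : A} {z : N} :
    Occurs l T (.inl i) z ↔ l i = z := Iff.rfl

@[simp] theorem occurs_inr {l : A → N} {T : E → List N} {p : E × ℕ} {z : N} :
    Occurs l T (.inr p) z ↔ (T p.1)[p.2]? = some z := Iff.rfl

theorem exists_occurs_of_mem (l : A → N) {T : E → List N} {e : E} {z : N} (h : z ∈ T e) :
    ∃ k, Occurs l T (.inr (e, k)) z := by
  simpa using List.mem_iff_getElem?.1 h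

/-- Packing existence and uniqueness into one position function `κ` lets later proofs build `κ` by
case analysis on a sum or by the universal property of a pushout. -/
theorem uniqueOcc_iff {l : A → N} {T : E → List N} :
    UniqueOcc l T ↔ ∃ κ : N → A ⊕ E × ℕ, ∀ q z, Occurs l T q z ↔ κ z = q := by
  constructor
  · intro h
    choose κ hκ hu using h
    exact ⟨κ, fun q z => ⟨fun hq => (hu z q hq).symm, by rintro rfl; exact hκ z⟩⟩
  · rintro ⟨κ, h⟩ z
    exact ⟨κ z, (h _ _).2 rfl, fun q hq => ((h q z).1 hq).symm⟩

theorem UniqueOcc.eq {l : A → N} {T : E → List N} (h : UniqueOcc l T) {q q' : A ⊕ E × ℕ} {z : N}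
    (hq : Occurs l T q z) (hq' : Occurs l T q' z) : q = q' :=
  (h z).unique hq hq'

theorem Occurs.map {l : A → N} {T : E → List N} {l' : A' → N'} {T' : E' → List N'} {φ : N → N'}
    {a : A → A'} {ε : E → E'} (hl : ∀ i, l' (a i) = φ (l i)) (hT : ∀ e, T' (ε e) = (T e).map φ)
    {q : A ⊕ E × ℕ} {z : N} (h : Occurs l T q z) :
    Occurs l' T' (Sum.map a (Prod.map ε id) q) (φ z) := by
  obtain i | ⟨e, k⟩ := q
  · exact (hl i).trans (congrArg φ h)
  · have h' : (T e)[k]? = some z := h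
    simp [hT, h']

/-- A position holds only one node, and `φ` sends the node at a position to the node at the
corresponding position. Nodes with equal images thus have equal positions, and the position of any
node of `N'` comes from one on the other side. -/
theorem UniqueOcc.bijective_of_bijective {l : A → N} {T : E → List N} {l' : A' → N'}
    {T' : E' → List N'} (h : UniqueOcc l T) (h' : UniqueOcc l' T') {φ : N → N'} {a : A → A'}
    {ε : E → E'} (hl : ∀ i, l' (a i) = φ (l i)) (hT : ∀ e, T' (ε e) = (T e).map φ)
    (ha : a.Bijective) (hε : ε.Bijective) : φ.Bijective := by
  constructor
  · intro z z' hz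
    obtain ⟨q, hq, -⟩ := h z
    obtain ⟨q', hq', -⟩ := h z'
    have e := h'.eq (hq.map hl hT) (hz ▸ hq'.map hl hT)
    obtain rfl := (Sum.map_injective.2 ⟨ha.1, hε.1.prodMap Function.injective_id⟩) e
    obtain i | ⟨e, k⟩ := q
    · exact hq.symm.trans hq'
    · exact Option.some_injective _ (Eq.trans (Eq.symm hq) hq')
  · intro z'
    obtain ⟨i | ⟨e, k⟩, hq, -⟩ := h' z'
    · obtain ⟨i, rfl⟩ := ha.2 i
      exact ⟨l i, (hl i).symm.trans hq⟩
    · obtain ⟨e, rfl⟩ := hε.2 e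
      simp only [occurs_inr, hT, List.getElem?_map, Option.map_eq_some_iff] at hq
      exact hq.imp fun _ => And.right

theorem UniqueOcc.congr {l : A → N} {T : E → List N} {l' : A' → N'} {T' : E' → List N'}
    (h : UniqueOcc l T) (a : A ≃ A') (ε : E ≃ E') (φ : N ≃ N') (hl : ∀ i, l' (a i) = φ (l i))
    (hT : ∀ e, T' (ε e) = (T e).map φ) : UniqueOcc l' T' := by
  intro z
  obtain ⟨q, hq, hu⟩ := h (φ.symm z)
  refine ⟨Sum.map a (Prod.map ε id) q, by simpa using hq.map hl hT, fun q' hq' => ?_⟩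
  have hl' : ∀ i, l (a.symm i) = φ.symm (l' i) := fun i => by
    rw [Equiv.eq_symm_apply, ← hl, Equiv.apply_symm_apply]
  have hT' : ∀ e, T (ε.symm e) = (T' e).map φ.symm := fun e => by
    obtain ⟨e, rfl⟩ := ε.surjective e
    simp [hT]
  rw [← hu _ (hq'.map hl' hT')]
  obtain i | ⟨e, k⟩ := q' <;> simp

theorem uniqueOcc_of_bijective [IsEmpty E] {l : A → N} (h : l.Bijective) (T : E → List N) :
    UniqueOcc l T := by
  intro z
  obtain ⟨i, hi, hu⟩ := h.existsUnique z
  refine ⟨.inl i, hi, ?_⟩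
  rintro (j | ⟨e, -⟩) hj
  · exact congrArg _ (hu j hj)
  · exact isEmptyElim e

theorem UniqueOcc.sum {l₁ : A → N₁} {T₁ : E₁ → List N₁} {l₂ : B → N₂} {T₂ : E₂ → List N₂}
    (h₁ : UniqueOcc l₁ T₁) (h₂ : UniqueOcc l₂ T₂) :
    UniqueOcc (Sum.map l₁ l₂)
      (Sum.elim (fun e => (T₁ e).map Sum.inl) (fun e => (T₂ e).map Sum.inr)) := by
  obtain ⟨κ₁, h₁⟩ := uniqueOcc_iff.1 h₁
  obtain ⟨κ₂, h₂⟩ := uniqueOcc_iff.1 h₂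
  refine uniqueOcc_iff.2 ⟨Sum.elim
    (fun z => Sum.map Sum.inl (Prod.map Sum.inl id) (κ₁ z))
    (fun z => Sum.map Sum.inr (Prod.map Sum.inr id) (κ₂ z)), ?_⟩
  rintro ((i | i) | ⟨e | e, k⟩) (z | z)
  · have := h₁ (.inl i) z
    rcases hz : κ₁ z with j | ⟨e', k'⟩ <;> simp_all
  · rcases hz : κ₂ z with j | ⟨e', k'⟩ <;> simp [hz]
  · rcases hz : κ₁ z with j | ⟨e', k'⟩ <;> simp [hz]
  · have := h₂ (.inl i) z
    rcases hz : κ₂ z with j | ⟨e', k'⟩ <;> simp_all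
  · have := h₁ (.inr (e, k)) z
    rcases hz : κ₁ z with j | ⟨e', k'⟩ <;> simp_all
  · rcases hz : κ₂ z with j | ⟨e', k'⟩ <;> simp [hz]
  · rcases hz : κ₁ z with j | ⟨e', k'⟩ <;> simp [hz]
  · have := h₂ (.inr (e, k)) z
    rcases hz : κ₂ z with j | ⟨e', k'⟩ <;> simp_all

/-- The square `f, g, p, q` is a pushout of types. -/
structure IsTypePushout (f : B → N₁) (g : B → N₂) (p : N₁ → N) (q : N₂ → N) : Prop where
  w : ∀ i, p (f i) = q (g i)
  -- Joint surjectivity takes the place of uniqueness in `desc`.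
  cover : ∀ z, (∃ x, p x = z) ∨ ∃ y, q y = z
  desc : ∀ {X : Type} (p' : N₁ → X) (q' : N₂ → X), (∀ i, p' (f i) = q' (g i)) →
    ∃ k : N → X, (∀ x, k (p x) = p' x) ∧ ∀ y, k (q y) = q' y

theorem IsTypePushout.flip {f : B → N₁} {g : B → N₂} {p : N₁ → N} {q : N₂ → N}
    (h : IsTypePushout f g p q) : IsTypePushout g f q p where
  w i := (h.w i).symm
  cover z := (h.cover z).symm
  desc p' q' hw := by
    obtain ⟨k, h₁, h₂⟩ := h.desc q' p' (fun i => (hw i).symm)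
    exact ⟨k, h₂, h₁⟩

end Occurrences

/-! ### Unique occurrences in a pushout of node sets. -/

section Pushout

variable {A B N N₁ N₂ E₁ E₂ : Type} {f : B → N₁} {g : B → N₂} {p : N₁ → N} {q : N₂ → N}

theorem UniqueOcc.pushout {l : A → N₁} {T₁ : E₁ → List N₁} {T₂ : E₂ → List N₂}
    (h₁ : UniqueOcc l T₁) (h₂ : UniqueOcc g T₂) (h : IsTypePushout f g p q) :
    UniqueOcc (p ∘ l) (Sum.elim (fun e => (T₁ e).map p) (fun e => (T₂ e).map q)) := by
  obtain ⟨κ₁, h₁⟩ := uniqueOcc_iff.1 h₁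
  obtain ⟨κ₂, h₂⟩ := uniqueOcc_iff.1 h₂
  let lift : A ⊕ E₁ × ℕ → A ⊕ (E₁ ⊕ E₂) × ℕ := Sum.map id (Prod.map Sum.inl id)
  -- A node of `N₂` on the interface, say `g i`, inherits the position of `f i` in the first factor;
  -- any other keeps its own position in a list of `T₂`.
  obtain ⟨κ, hp, hq⟩ := h.desc (fun x => lift (κ₁ x))
    (fun y => Sum.elim (fun i => lift (κ₁ (f i))) (fun r => .inr (.inr r.1, r.2)) (κ₂ y))
    (fun i => by simp [(h₂ (.inl i) (g i)).1 rfl])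
  have hleft : ∀ x, Occurs (p ∘ l)
      (Sum.elim (fun e => (T₁ e).map p) (fun e => (T₂ e).map q)) (lift (κ₁ x)) (p x) := by
    intro x
    apply Occurs.map (l := l) (T := T₁)
    exacts [fun _ => rfl, fun _ => rfl, (h₁ _ x).2 rfl]
  refine uniqueOcc_iff.2 ⟨κ, fun r z => ⟨fun hr => ?_, ?_⟩⟩
  · obtain i | ⟨e | e, k⟩ := r
    · obtain rfl := hr
      rw [Function.comp_apply, hp, (h₁ (.inl i) (l i)).1 rfl]
      rfl
    · simp only [occurs_inr, Sum.elim_inl, List.getElem?_map, Option.map_eq_some_iff] at hr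
      obtain ⟨x, hx, rfl⟩ := hr
      rw [hp, (h₁ (.inr (e, k)) x).1 hx]
      rfl
    · simp only [occurs_inr, Sum.elim_inr, List.getElem?_map, Option.map_eq_some_iff] at hr
      obtain ⟨y, hy, rfl⟩ := hr
      rw [hq, (h₂ (.inr (e, k)) y).1 hy]
      rfl
  · rintro rfl
    obtain ⟨x, rfl⟩ | ⟨y, rfl⟩ := h.cover z
    · rw [hp]
      exact hleft x
    · rw [hq]
      have hy := (h₂ _ y).2 rfl
      rcases hκ : κ₂ y with i | ⟨e, k⟩
      · rw [hκ] at hy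
        obtain rfl := hy
        rw [← h.w]
        exact hleft (f i)
      · rw [hκ] at hy
        simpa using ⟨y, hy, rfl⟩

/-- Gluing neither identifies two nodes of `N₁` nor identifies one of them with a node listed in
`T₂`: such a node has its only occurrence there, hence is off the interface, and `k` can send it to
`none`. -/
theorem IsTypePushout.exists_retraction (h : IsTypePushout f g p q) {T₂ : E₂ → List N₂}
    (h₂ : UniqueOcc g T₂) :
    ∃ k : N → Option N₁, (∀ x, k (p x) = some x) ∧ ∀ e, ∀ y ∈ T₂ e, k (q y) = none := by
  obtain ⟨κ₂, hκ⟩ := uniqueOcc_iff.1 h₂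
  obtain ⟨k, hp, hq⟩ := h.desc some
    (fun y => Sum.elim (fun i => some (f i)) (fun _ => none) (κ₂ y))
    (fun i => by simp [(hκ (.inl i) (g i)).1 rfl])
  refine ⟨k, hp, fun e y hy => ?_⟩
  obtain ⟨n, hn⟩ := exists_occurs_of_mem g hy
  rw [hq, (hκ _ _).1 hn, Sum.elim_inr]

end Pushout

/-! ## Monogamy in terms of unique occurrences -/

section Degrees

variable {A N E : Type*}

open Classical in
theorem uniqueOcc_iff_encard {l : A → N} {T : E → List N} :
    UniqueOcc l T ↔ l.Injective ∧
      ∀ z, {p : E × ℕ | (T p.1)[p.2]? = some z}.encard = if z ∈ Set.range l then 0 else 1 := by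
  constructor
  · refine fun h => ⟨fun i j hij => Sum.inl_injective (h.eq (z := l j) hij rfl), fun z => ?_⟩
    split_ifs with hz
    · obtain ⟨i, rfl⟩ := hz
      rw [Set.encard_eq_zero, Set.eq_empty_iff_forall_notMem]
      intro p hp
      exact Sum.inl_ne_inr (h.eq (q := .inl i) (q' := .inr p) rfl hp)
    · obtain ⟨i | p, hp, hu⟩ := h z
      · exact absurd ⟨i, hp⟩ hz
      · exact Set.encard_eq_one.2 ⟨p, Set.eq_singleton_iff_unique_mem.2
          ⟨hp, fun p' hp' => Sum.inr_injective (hu (.inr p') hp')⟩⟩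
  · rintro ⟨hl, h⟩ z
    have hz := h z
    split_ifs at hz with hr
    · obtain ⟨i, rfl⟩ := hr
      rw [Set.encard_eq_zero, Set.eq_empty_iff_forall_notMem] at hz
      refine ⟨.inl i, rfl, ?_⟩
      rintro (j | p) hj
      · exact congrArg _ (hl hj)
      · exact absurd hj (hz p)
    · obtain ⟨p, hp⟩ := Set.encard_eq_one.1 hz
      rw [Set.eq_singleton_iff_unique_mem] at hp
      refine ⟨.inr p, hp.1, ?_⟩
      rintro (j | p') hj
      · exact absurd ⟨j, hj⟩ hr
      · exact congrArg _ (hp.2 p' hj)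

theorem UniqueOcc.nodup {l : A → N} {T : E → List N} (h : UniqueOcc l T) (e : E) :
    (T e).Nodup := by
  refine List.nodup_iff_injective_getElem.2 fun i j hij => ?_
  have hi : Occurs l T (.inr (e, i.1)) (T e)[j.1] := by simpa using hij
  have hj : Occurs l T (.inr (e, j.1)) (T e)[j.1] := by simp
  simpa [Fin.ext_iff] using h.eq hi hj

theorem UniqueOcc.disjoint {l : A → N} {T : E → List N} (h : UniqueOcc l T) {e e' : E}
    (he : e ≠ e') : (T e).Disjoint (T e') := by
  intro z hz hz'
  obtain ⟨k, hk⟩ := exists_occurs_of_mem l hz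
  obtain ⟨k', hk'⟩ := exists_occurs_of_mem l hz'
  exact he (Prod.ext_iff.1 (Sum.inr_injective (h.eq hk hk'))).1

/-- With `UniqueOcc.mem_append`: when `L` enumerates all hyperedges, the concatenated list
enumerates all nodes without repetition. -/
theorem UniqueOcc.nodup_append {n : ℕ} {l : Fin n → N} {T : E → List N} (h : UniqueOcc l T)
    {L : List E} (hL : L.Nodup) : (List.ofFn l ++ L.flatMap T).Nodup := by
  refine List.nodup_append'.2 ⟨List.nodup_ofFn.2 fun i j hij => Sum.inl_injective
    (h.eq (z := l j) hij rfl), List.nodup_flatMap.2 ⟨fun e _ => h.nodup e, ?_⟩, ?_⟩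
  · exact List.Pairwise.imp (fun he => h.disjoint he) hL
  · intro z hz hz'
    obtain ⟨i, rfl⟩ := List.mem_ofFn.1 hz
    obtain ⟨e, -, he⟩ := List.mem_flatMap.1 hz'
    obtain ⟨k, hk⟩ := exists_occurs_of_mem l he
    exact Sum.inl_ne_inr (h.eq (q := .inl i) rfl hk)

theorem UniqueOcc.mem_append {n : ℕ} {l : Fin n → N} {T : E → List N} (h : UniqueOcc l T)
    {L : List E} (hL : ∀ e, e ∈ L) (z : N) : z ∈ List.ofFn l ++ L.flatMap T := by
  obtain ⟨i | ⟨e, k⟩, hq, -⟩ := h z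
  · exact List.mem_append_left _ (List.mem_ofFn.2 ⟨i, hq⟩)
  · exact List.mem_append_right _ (List.mem_flatMap.2 ⟨e, hL e, List.mem_of_getElem? hq⟩)

/-- The lists are pairwise disjoint, so choosing a member of each nonempty one is an injection into
`N`. -/
theorem UniqueOcc.finite_setOf_ne_nil [Finite N] {l : A → N} {T : E → List N}
    (h : UniqueOcc l T) : {e | T e ≠ []}.Finite := by
  have hT (e : {e | T e ≠ []}) : ∃ z, z ∈ T e.1 := List.exists_mem_of_ne_nil _ e.2
  choose z hz using hT
  have : Finite {e | T e ≠ []} := Finite.of_injective z fun e e' he => by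
    by_contra hne
    exact h.disjoint (fun h' => hne (Subtype.ext h')) (hz e) (he ▸ hz e')
  exact Set.toFinite _

theorem uniqueOcc_finRange (A : Type*) (n : ℕ) :
    UniqueOcc (Sum.inl : A → A ⊕ Fin n) (fun _ : Unit => (List.finRange n).map Sum.inr) := by
  refine uniqueOcc_iff.2 ⟨Sum.map id fun i => ((), i.1), ?_⟩
  rintro (i | ⟨-, k⟩) (j | j)
  · simp [eq_comm]
  · simp
  · simp
  · simp only [occurs_inr, List.getElem?_map, Option.map_eq_some_iff, Sum.inr.injEq,
      exists_eq_right, Sum.map_inr, Prod.mk.injEq, true_and]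
    exact ⟨fun h => by simpa [Fin.ext_iff, eq_comm] using (List.getElem?_eq_some_iff.1 h).2,
      fun h => by subst h; simp⟩

end Degrees

/-! ### Monos, isomorphisms and gluing of hypergraphs, read on nodes and hyperedges. -/

namespace LHyp

variable {C : Type u} {S : Signature.{u, v} C}

theorem mono_disc_iff {w : List C} {G : LHyp S} (f : disc S w ⟶ G) :
    Mono f ↔ f.node.Injective := by
  constructor
  · intro hf i j hij
    -- Test against the one-node discrete hypergraph. It can point to both `i` and `j` because nodes
    -- with the same image under `f` carry the same colour.
    let pick (k : Fin w.length) (hk : w.get k = w.get i) : disc S [w.get i] ⟶ disc S w :=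
      ofDisc (fun _ => k) (fun m => by
        have : m = ⟨0, by simp⟩ := Subsingleton.elim (α := Fin 1) _ _
        subst this
        exact hk)
    have hj : w.get j = w.get i :=
      (f.label_node j).symm.trans ((congrArg G.label.node hij.symm).trans (f.label_node i))
    have := (cancel_mono f).1 (disc_ext (fun _ => hij) : pick i rfl ≫ f = pick j hj ≫ f)
    exact congrArg (fun k : disc S [w.get i] ⟶ disc S w => k.node (⟨0, by simp⟩ : Fin 1)) this
  · refine fun hf => ⟨fun g h hgh => hom_ext (fun z => hf ?_) (fun e => (g.edge e).elim)⟩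
    exact congrArg (fun k : _ ⟶ G => k.node z) hgh

theorem isIso_of_bijective {G H : LHyp S} (f : G ⟶ H) (hn : f.node.Bijective)
    (he : f.edge.Bijective) : IsIso f := by
  let n := Equiv.ofBijective f.node hn
  let e := Equiv.ofBijective f.edge he
  have hne : ∀ z, f.node (n.symm z) = z := n.apply_symm_apply
  have hee : ∀ z, f.edge (e.symm z) = z := e.apply_symm_apply
  refine ⟨⟨⟨⟨n.symm, e.symm, fun z => ?_, fun z => ?_⟩, fun z => ?_, fun z => ?_⟩,
    hom_ext n.symm_apply_apply e.symm_apply_apply, hom_ext hne hee⟩⟩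
  · apply hn.1.list_map
    rw [← f.src_edge, hee, List.map_map]
    exact ((List.map_congr_left fun z _ => hne z).trans (List.map_id _)).symm
  · apply hn.1.list_map
    rw [← f.tgt_edge, hee, List.map_map]
    exact ((List.map_congr_left fun z _ => hne z).trans (List.map_id _)).symm
  · rw [← f.label_node, hne]
  · rw [← f.label_edge, hee]

theorem bijective_of_iso {G H : LHyp S} (i : G ≅ H) :
    i.hom.node.Bijective ∧ i.hom.edge.Bijective := by
  refine ⟨Function.bijective_iff_has_inverse.2 ⟨i.inv.node, fun z => ?_, fun z => ?_⟩,
    Function.bijective_iff_has_inverse.2 ⟨i.inv.edge, fun z => ?_, fun z => ?_⟩⟩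
  · exact congrArg (fun k : G ⟶ G => k.node z) i.hom_inv_id
  · exact congrArg (fun k : H ⟶ H => k.node z) i.inv_hom_id
  · exact congrArg (fun k : G ⟶ G => k.edge z) i.hom_inv_id
  · exact congrArg (fun k : H ⟶ H => k.edge z) i.inv_hom_id

theorem glue_isTypePushout {w : List C} {G H : LHyp S} (f : disc S w ⟶ G) (g : disc S w ⟶ H) :
    IsTypePushout (B := Fin w.length) f.node g.node (glueInl f g).node (glueInr f g).node where
  w i := Quot.sound ⟨i, rfl, rfl⟩
  cover := by
    rintro ⟨z | z⟩
    exacts [.inl ⟨z, rfl⟩, .inr ⟨z, rfl⟩]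
  desc p' q' h := ⟨Quot.lift (Sum.elim p' q') (by rintro _ _ ⟨i, rfl, rfl⟩; exact h i),
    fun _ => rfl, fun _ => rfl⟩

theorem glue_src {w : List C} {G H : LHyp S} (f : disc S w ⟶ G) (g : disc S w ⟶ H) :
    (glue f g).src = Sum.elim (fun e => (G.src e).map (glueInl f g).node)
      (fun e => (H.src e).map (glueInr f g).node) := by
  funext e
  obtain e | e := e
  exacts [(glueInl f g).src_edge e, (glueInr f g).src_edge e]

theorem glue_tgt {w : List C} {G H : LHyp S} (f : disc S w ⟶ G) (g : disc S w ⟶ H) :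
    (glue f g).tgt = Sum.elim (fun e => (G.tgt e).map (glueInl f g).node)
      (fun e => (H.tgt e).map (glueInr f g).node) := by
  funext e
  obtain e | e := e
  exacts [(glueInl f g).tgt_edge e, (glueInr f g).tgt_edge e]

/-- The positions of a concatenation of words. -/
def appendEquiv (a b : List C) : Fin a.length ⊕ Fin b.length ≃ Fin (a ++ b).length :=
  finSumFinEquiv.trans (finCongr List.length_append.symm)

theorem discDesc_appendEquiv {a b : List C} {G : LHyp S} (f : disc S a ⟶ G) (g : disc S b ⟶ G)
    (i : Fin a.length ⊕ Fin b.length) :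
    (discDesc f g).node (appendEquiv a b i) = Sum.elim f.node g.node i := by
  obtain i | i := i
  · exact congrArg (fun k : disc S a ⟶ G => k.node i) (discL_discDesc f g)
  · exact congrArg (fun k : disc S b ⟶ G => k.node i) (discR_discDesc f g)

end LHyp

/-! ### Linear cospans: isomorphism invariance and closure under the PROP structure. -/

namespace Cospan

variable {C : Type u} {S : Signature.{u, v} C} {a b c d : List C}

/-- Every node is exactly once an input or a target, and exactly once an output or a source. -/
def Linear (s : Cospan S a b) : Prop :=
  UniqueOcc s.left.node s.carrier.tgt ∧
    UniqueOcc s.right.node s.carrier.src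

theorem monogamous_iff_linear {s : Cospan S a b} : s.Monogamous ↔ s.Linear := by
  rw [Monogamous, mono_disc_iff, mono_disc_iff]
  refine Iff.trans ?_ (and_congr uniqueOcc_iff_encard uniqueOcc_iff_encard).symm
  exact ⟨fun ⟨h, h', k⟩ => ⟨⟨h, fun z => (k z).1⟩, h', fun z => (k z).2⟩,
    fun ⟨⟨h, k⟩, h', k'⟩ => ⟨h, h', fun z => ⟨k z, k' z⟩⟩⟩

/-- Input and target positions alone determine the nodes, so bijectivity on nodes follows from
bijectivity on hyperedges and compatibility with the left legs. -/
theorem Linear.equiv_of_hom {s t : Cospan S a b} (hs : s.Linear) (ht : t.Linear)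
    (φ : s.carrier ⟶ t.carrier) (hl : s.left ≫ φ = t.left) (hr : s.right ≫ φ = t.right)
    (hφ : φ.edge.Bijective) : setoid S a b s t := by
  have hn : φ.node.Bijective := hs.1.bijective_of_bijective ht.1 (a := _root_.id)
    (fun i => congrArg (fun k : disc S a ⟶ t.carrier => k.node i) hl.symm) φ.tgt_edge
    Function.bijective_id hφ
  have := isIso_of_bijective φ hn hφ
  exact ⟨asIso φ, hl, hr⟩

theorem Linear.of_equiv {s t : Cospan S a b} (hs : s.Linear) (h : setoid S a b s t) :
    t.Linear := by
  obtain ⟨i, hl, hr⟩ := h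
  obtain ⟨hn, he⟩ := bijective_of_iso i
  exact ⟨hs.1.congr (.refl _) (.ofBijective _ he) (.ofBijective _ hn)
      (fun j => congrArg (fun k : disc S a ⟶ t.carrier => k.node j) hl.symm) i.hom.tgt_edge,
    hs.2.congr (.refl _) (.ofBijective _ he) (.ofBijective _ hn)
      (fun j => congrArg (fun k : disc S b ⟶ t.carrier => k.node j) hr.symm) i.hom.src_edge⟩

theorem Linear.comp {s : Cospan S a b} {t : Cospan S b c} (hs : s.Linear) (ht : t.Linear) :
    (comp s t).Linear := by
  have h := glue_isTypePushout s.right t.left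
  constructor
  · show UniqueOcc _ (glue s.right t.left).tgt
    rw [glue_tgt]
    exact hs.1.pushout ht.1 h
  · show UniqueOcc _ (glue s.right t.left).src
    rw [glue_src]
    -- For sources the factors exchange roles: the outer leg belongs to `t` and the interface to the
    -- right leg of `s`. Hence the flipped pushout and the swap of hyperedges.
    refine (ht.2.pushout hs.2 h.flip).congr (.refl _) (.sumComm _ _) (.refl _) (fun _ => rfl) ?_
    rintro (e | e) <;> exact (List.map_id _).symm

theorem Linear.tensor {s : Cospan S a b} {t : Cospan S c d} (hs : s.Linear) (ht : t.Linear) :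
    (tensor s t).Linear := by
  refine ⟨(hs.1.sum ht.1).congr (appendEquiv a c) (.refl _) (.refl _) (fun i => ?_) fun _ => (List.map_id _).symm,
    (hs.2.sum ht.2).congr (appendEquiv b d) (.refl _) (.refl _) (fun i => ?_) fun _ => (List.map_id _).symm⟩
  · exact (discDesc_appendEquiv _ _ i).trans (by cases i <;> rfl)
  · exact (discDesc_appendEquiv _ _ i).trans (by cases i <;> rfl)

theorem Linear.id (a : List C) : (id S a).Linear :=
  have : IsEmpty (disc S a).Edge := inferInstanceAs (IsEmpty Empty)
  ⟨uniqueOcc_of_bijective Function.bijective_id _, uniqueOcc_of_bijective Function.bijective_id _⟩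

theorem Linear.symm (a b : List C) : (symm S a b).Linear :=
  have : IsEmpty (disc S (a ++ b)).Edge := inferInstanceAs (IsEmpty Empty)
  ⟨uniqueOcc_of_bijective Function.bijective_id _,
    uniqueOcc_of_bijective (bijective_of_iso (swap S a b)).1 _⟩

theorem Linear.op (o : S.Op) : (op S o).Linear := by
  refine ⟨uniqueOcc_finRange (Fin (S.dom o).length) (S.cod o).length,
    (uniqueOcc_finRange (Fin (S.cod o).length) (S.dom o).length).congr (.refl _) (.refl _)
      (.sumComm _ _) (fun _ => rfl) fun _ => ?_⟩
  exact (List.map_map (f := Sum.inr) (g := Sum.swap)).symm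

/-! ## Acyclicity in terms of ranks -/

/-- The hyperedges have a bounded rank that increases along successors. -/
def Ranked (s : Cospan S a b) : Prop :=
  ∃ (r : s.carrier.Edge → ℕ) (n : ℕ), (∀ e, r e < n) ∧
    ∀ e e', s.carrier.IsSuccessor e e' → r e < r e'

/-- Ranks increase from the first hyperedge of a path to the last; on a closed path the first is
moreover a successor of the last. -/
theorem Ranked.acyclic {s : Cospan S a b} (h : s.Ranked) : s.Acyclic := by
  obtain ⟨r, -, -, hr⟩ := h
  rintro z (_ | ⟨e, p⟩) ⟨hp, ⟨e₀, he₀, hz⟩, e₁, he₁, hz'⟩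
  · simp at he₀
  · obtain rfl : e = e₀ := by simpa using he₀
    have hlt := hr e₁ e ⟨z, hz', hz⟩
    have hmono : ((e :: p).map r).Pairwise (· < ·) := by
      rw [← List.isChain_iff_pairwise, List.isChain_map]
      exact hp.imp fun _ _ => hr _ _
    have hmem : e₁ ∈ e :: p := List.mem_of_mem_getLast? he₁
    rw [List.map_cons, List.pairwise_cons] at hmono
    obtain rfl | hmem := List.mem_cons.1 hmem
    · exact lt_irrefl _ hlt
    · exact lt_asymm hlt (hmono.1 _ (List.mem_map_of_mem hmem))

theorem Ranked.of_equiv {s t : Cospan S a b} (hs : s.Ranked) (h : setoid S a b s t) :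
    t.Ranked := by
  obtain ⟨r, n, hn, hr⟩ := hs
  obtain ⟨i, -, -⟩ := h
  refine ⟨r ∘ i.inv.edge, n, fun e => hn _, fun e e' ⟨z, hz, hz'⟩ => hr _ _ ⟨i.inv.node z, ?_, ?_⟩⟩
  · rw [i.inv.tgt_edge]
    exact List.mem_map_of_mem hz
  · rw [i.inv.src_edge]
    exact List.mem_map_of_mem hz'

theorem Ranked.comp {s : Cospan S a b} {t : Cospan S b c} (hs : s.Ranked) (ht : t.Ranked)
    (ls : s.Linear) (lt : t.Linear) : (comp s t).Ranked := by
  obtain ⟨r, n, hn, hr⟩ := hs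
  obtain ⟨r', n', hn', hr'⟩ := ht
  have h := glue_isTypePushout s.right t.left
  obtain ⟨k, hk, hk'⟩ := h.exists_retraction lt.1
  obtain ⟨k', hk₂, -⟩ := h.flip.exists_retraction ls.2
  -- The bound `n` on the ranks of `s` is the shift that puts every hyperedge of `t` above those of
  -- `s`.
  refine ⟨Sum.elim r (fun e => n + r' e), n + n', ?_, ?_⟩
  · rintro (e | e)
    · exact (hn e).trans_le (Nat.le_add_right _ _)
    · exact Nat.add_lt_add_left (hn' e) n
  · show ∀ e e' : s.carrier.Edge ⊕ t.carrier.Edge, (glue s.right t.left).IsSuccessor e e' → _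
    rintro e e' ⟨z, hz, hz'⟩
    rw [glue_tgt] at hz
    rw [glue_src] at hz'
    obtain e | e := e <;> obtain e' | e' := e' <;>
      obtain ⟨x, hx, rfl⟩ := List.mem_map.1 hz <;> obtain ⟨y, hy, hxy⟩ := List.mem_map.1 hz'
    · obtain rfl : y = x := Option.some_injective _ (by rw [← hk, ← hk, hxy])
      exact hr e e' ⟨y, hx, hy⟩
    · exact (hn e).trans_le (Nat.le_add_right _ _)
    -- A hyperedge of `s` cannot succeed one of `t`: a target in `t` is sent to `none` by the
    -- retraction, a node of `s` is not.
    · have := hk' e x hx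
      rw [← hxy, hk] at this
      cases this
    · obtain rfl : y = x := Option.some_injective _ (by rw [← hk₂, ← hk₂, hxy])
      exact Nat.add_lt_add_left (hr' e e' ⟨y, hx, hy⟩) n

theorem Ranked.tensor {s : Cospan S a b} {t : Cospan S c d} (hs : s.Ranked) (ht : t.Ranked) :
    (tensor s t).Ranked := by
  obtain ⟨r, n, hn, hr⟩ := hs
  obtain ⟨r', n', hn', hr'⟩ := ht
  refine ⟨Sum.elim r r', max n n', ?_, ?_⟩
  · rintro (e | e)
    · exact lt_max_of_lt_left (hn e)
    · exact lt_max_of_lt_right (hn' e)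
  · rintro (e | e) (e' | e') ⟨z, hz, hz'⟩ <;> obtain ⟨x, hx, rfl⟩ := List.mem_map.1 hz <;>
      obtain ⟨y, hy, hxy⟩ := List.mem_map.1 hz' <;> cases hxy
    · exact hr e e' ⟨_, hx, hy⟩
    · exact hr' e e' ⟨_, hx, hy⟩

theorem Ranked.id (a : List C) : (id S a).Ranked :=
  ⟨Empty.elim, 0, fun e => e.elim, fun e => e.elim⟩

theorem Ranked.symm (a b : List C) : (symm S a b).Ranked :=
  ⟨Empty.elim, 0, fun e => e.elim, fun e => e.elim⟩

theorem Ranked.op (o : S.Op) : (op S o).Ranked := by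
  refine ⟨fun _ => 0, 1, fun _ => one_pos, ?_⟩
  rintro e e' ⟨z, hz, hz'⟩
  obtain ⟨x, -, rfl⟩ := List.mem_map.1 hz
  obtain ⟨y, -, hxy⟩ := List.mem_map.1 hz'
  cases hxy

end Cospan

/-! ## Cospans of terms -/

section Terms

variable {C : Type u} {S : Signature.{u, v} C} {a b : List C}

/-- The cospan denoted by a term. -/
def Term.cospan : ∀ {a b : List C}, Term S a b → Cospan S a b
  | _, _, .op o => Cospan.op S o
  | _, _, .id a => Cospan.id S a
  | _, _, .symm a b => Cospan.symm S a b
  | _, _, .comp s t => Cospan.comp s.cospan t.cospan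
  | _, _, .tensor s t => Cospan.tensor s.cospan t.cospan

theorem Term.eval_eq_toHom_cospan (t : Term S a b) :
    t.eval (Csp S) (fun o => (Cospan.op S o).toHom) = t.cospan.toHom := by
  induction t with
  | op o => rfl
  | id a => rfl
  | symm a b => rfl
  | comp s t hs ht => rw [Term.eval, hs, ht]; rfl
  | tensor s t hs ht => rw [Term.eval, hs, ht]; rfl

/-- Removes both quotients: what remains concerns actual terms and actual cospans, whose carriers
can be inspected. -/
theorem exists_interpretation_eq_iff {G : Cospan S a b} :
    (∃ t : (Syn S).Hom a b, (interpretation S).map t = G.toHom) ↔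
      ∃ t : Term S a b, Cospan.setoid S a b t.cospan G := by
  constructor
  · rintro ⟨⟨t⟩, ht⟩
    exact ⟨t, Quotient.exact (t.eval_eq_toHom_cospan.symm.trans ht)⟩
  · rintro ⟨t, ht⟩
    exact ⟨Quotient.mk _ t, t.eval_eq_toHom_cospan.trans (Quotient.sound ht)⟩

theorem Term.linear_cospan (t : Term S a b) : t.cospan.Linear := by
  induction t with
  | op o => exact .op o
  | id a => exact .id a
  | symm a b => exact .symm a b
  | comp s t hs ht => exact hs.comp ht
  | tensor s t hs ht => exact hs.tensor ht

theorem Term.ranked_cospan (t : Term S a b) : t.cospan.Ranked := by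
  induction t with
  | op o => exact .op o
  | id a => exact .id a
  | symm a b => exact .symm a b
  | comp s t hs ht => exact hs.comp ht s.linear_cospan t.linear_cospan
  | tensor s t hs ht => exact hs.tensor ht

end Terms

/-! ## Topological sorting of the hyperedges -/

namespace DirHypergraph

theorem Acyclic.irreflexive_transGen {G : DirHypergraph.{x, y}} (h : G.Acyclic) (e : G.Edge) :
    ¬ Relation.TransGen G.IsSuccessor e e := by
  intro he
  -- The node `z` is a target of `e` and a source of `e'`, so the chain from `e'` back to `e` is a
  -- path from `z` to itself.
  obtain ⟨e', ⟨z, hz, hz'⟩, hr⟩ := Relation.TransGen.head'_iff.1 he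
  obtain ⟨l, hl, hlast⟩ := List.exists_isChain_cons_of_relationReflTransGen hr
  exact h z (e' :: l) ⟨hl, ⟨e', by simp, hz'⟩, e,
    by rw [List.getLast?_eq_getLast_of_ne_nil (List.cons_ne_nil _ _), hlast]; rfl, hz⟩

theorem Acyclic.exists_topological_sort {G : DirHypergraph.{x, y}} (h : G.Acyclic)
    [Finite G.Edge] : ∃ L : List G.Edge, L.Nodup ∧ (∀ e, e ∈ L) ∧
      L.Pairwise (fun e e' => ¬ G.IsSuccessor e' e) := by
  classical
  have := Fintype.ofFinite G.Edge
  have : Std.Irrefl (Relation.TransGen G.IsSuccessor) := ⟨h.irreflexive_transGen⟩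
  have hwf := Finite.wellFounded_of_trans_of_irrefl (Relation.TransGen G.IsSuccessor)
  suffices hA : ∀ A : Finset G.Edge, ∃ L : List G.Edge, L.Nodup ∧ (∀ e, e ∈ L ↔ e ∈ A) ∧
      L.Pairwise (fun e e' => ¬ G.IsSuccessor e' e) by
    obtain ⟨L, h₁, h₂, h₃⟩ := hA Finset.univ
    exact ⟨L, h₁, fun e => (h₂ e).2 (Finset.mem_univ e), h₃⟩
  intro A
  induction A using Finset.strongInduction with
  | H A ih =>
    obtain rfl | hA := A.eq_empty_or_nonempty
    · exact ⟨[], by simp, by simp, by simp⟩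
    -- A hyperedge of `A` that succeeds no other member of `A` may be listed first.
    · obtain ⟨m, hm, hmin⟩ := hwf.has_min (A : Set G.Edge) hA
      obtain ⟨L, h₁, h₂, h₃⟩ := ih (A.erase m) (Finset.erase_ssubset hm)
      refine ⟨m :: L, List.nodup_cons.2 ⟨by simp [h₂], h₁⟩, fun e => ?_,
        List.pairwise_cons.2 ⟨fun e he hs => ?_, h₃⟩⟩
      · by_cases he : e = m
        · simpa [he] using hm
        · simp [h₂, he]
      · exact hmin e (Finset.mem_of_mem_erase ((h₂ e).1 he)) (.single hs)

end DirHypergraph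

/-- An `LHyp` only has finitely many hyperedges of each arity. Linearity bounds those with a source
or a target by the finite node set; those with neither all have arity `(0, 0)`. -/
theorem Cospan.Linear.finite_edge {C : Type u} {S : Signature.{u, v} C} {a b : List C}
    {s : Cospan S a b} (h : s.Linear) : Finite s.carrier.Edge := by
  have := s.carrier.finite_node
  refine Set.finite_univ_iff.1 ((h.1.finite_setOf_ne_nil.union (h.2.finite_setOf_ne_nil.union
    (s.carrier.finite_edge 0 0))).subset fun e _ => ?_)
  by_cases ht : s.carrier.tgt e = []
  · by_cases hs : s.carrier.src e = []
    · exact .inr (.inr (by simp [hs, ht]))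
    · exact .inr (.inl hs)
  · exact .inl ht

/-! ## Tracing a hypergraph by terms -/

namespace LHyp

variable {C : Type u} {S : Signature.{u, v} C} {G : LHyp S}

/-- The list of nodes enumerated by a morphism out of a discrete hypergraph. -/
def nodes {w : List C} (f : disc S w ⟶ G) : List G.Node :=
  List.ofFn (n := w.length) f.node

/-- A list of nodes determines its word. `Traced` can therefore leave its words existential, and
rebracketing frontiers needs no transport of terms. -/
theorem map_label_nodes {w : List C} (f : disc S w ⟶ G) : (nodes f).map G.label.node = w := by
  exact List.map_ofFn.trans ((congrArg List.ofFn (funext f.label_node)).trans (List.ofFn_get w))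

@[simp] theorem length_nodes {w : List C} (f : disc S w ⟶ G) : (nodes f).length = w.length :=
  List.length_ofFn

theorem getElem_nodes {w : List C} (f : disc S w ⟶ G) {i : ℕ} (h : i < (nodes f).length) :
    (nodes f)[i] = f.node (⟨i, by simpa using h⟩ : Fin w.length) :=
  List.getElem_ofFn _

theorem exists_nodes_eq {F : List G.Node} {w : List C} (h : F.map G.label.node = w) :
    ∃ f : disc S w ⟶ G, nodes f = F := by
  subst h
  refine ⟨ofDisc (fun i => F[i.1]'(i.2.trans_eq (List.length_map _)))
    (fun i => (List.getElem_map G.label.node).symm), ?_⟩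
  exact List.ext_getElem ((length_nodes _).trans (List.length_map _)) fun i h₁ h₂ =>
    getElem_nodes _ _

theorem nodes_injective {w : List C} : Function.Injective (nodes : (disc S w ⟶ G) → _) :=
  fun _ _ h => disc_ext (congrFun (List.ofFn_injective h))

theorem nodes_discDesc {a b : List C} (f : disc S a ⟶ G) (g : disc S b ⟶ G) :
    nodes (discDesc f g) = nodes f ++ nodes g := by
  refine List.ext_getElem (by simp) fun i h₁ h₂ => ?_
  rw [List.getElem_append]
  simp only [getElem_nodes, length_nodes]
  rfl

/-- Some term from the labels of `F` to those of `F'` is interpreted by a cospan that maps to `G`,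
with its inputs going to `F`, its outputs to `F'`, and its hyperedges bijectively to `A`. -/
def Traced (A : Set G.Edge) (F F' : List G.Node) : Prop :=
  ∃ (w v : List C) (t : Term S w v) (φ : t.cospan.carrier ⟶ G),
    nodes (t.cospan.left ≫ φ) = F ∧ nodes (t.cospan.right ≫ φ) = F' ∧
      φ.edge.Injective ∧ Set.range φ.edge = A

theorem Traced.id (F : List G.Node) : Traced ∅ F F := by
  obtain ⟨w, f, rfl⟩ : ∃ w, ∃ f : disc S w ⟶ G, nodes f = F := ⟨_, exists_nodes_eq rfl⟩
  exact ⟨w, w, .id w, f, congrArg nodes (Category.id_comp f), congrArg nodes (Category.id_comp f),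
    fun e => e.elim, Set.range_eq_empty (ι := Empty) _⟩

theorem Traced.symm (F K : List G.Node) : Traced ∅ (F ++ K) (K ++ F) := by
  obtain ⟨w, f, rfl⟩ : ∃ w, ∃ f : disc S w ⟶ G, nodes f = F := ⟨_, exists_nodes_eq rfl⟩
  obtain ⟨v, k, rfl⟩ : ∃ v, ∃ k : disc S v ⟶ G, nodes k = K := ⟨_, exists_nodes_eq rfl⟩
  refine ⟨_, _, .symm w v, discDesc f k, ?_, ?_, fun e => e.elim,
    Set.range_eq_empty (ι := Empty) _⟩
  · rw [← nodes_discDesc]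
    exact congrArg nodes (Category.id_comp _)
  · rw [← nodes_discDesc]
    exact congrArg nodes (by simp [Term.cospan, Cospan.discDesc_comp])

theorem injective_sumElim_of_disjoint {α β γ : Type*} {f : α → γ} {g : β → γ} (hf : f.Injective)
    (hg : g.Injective) (h : Disjoint (Set.range f) (Set.range g)) :
    (Sum.elim f g).Injective :=
  hf.sumElim hg fun a b hab => Set.disjoint_left.1 h ⟨a, rfl⟩ ⟨b, hab.symm⟩

theorem Traced.comp {A B : Set G.Edge} {F F' F'' : List G.Node} (h : Traced A F F')
    (h' : Traced B F' F'') (hAB : Disjoint A B) : Traced (A ∪ B) F F'' := by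
  obtain ⟨w, v, t, φ, rfl, hF', hφ, rfl⟩ := h
  obtain ⟨v', w', t', ψ, hF'', rfl, hψ, rfl⟩ := h'
  obtain rfl : v = v' := by
    rw [← map_label_nodes (t.cospan.right ≫ φ), hF', ← hF'', map_label_nodes]
  -- Both maps enumerate `F'` on the interface, so they agree there and factor through the pushout.
  have hw := nodes_injective (hF'.trans hF''.symm)
  have hp := glue_isPushout t.cospan.right t'.cospan.left
  have he : (hp.desc φ ψ hw).edge = Sum.elim φ.edge ψ.edge := by
    funext e
    obtain e | e := e
    · exact congrArg (fun k : _ ⟶ G => k.edge e) (hp.inl_desc φ ψ hw)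
    · exact congrArg (fun k : _ ⟶ G => k.edge e) (hp.inr_desc φ ψ hw)
  refine ⟨_, _, .comp t t', hp.desc φ ψ hw, congrArg nodes ?_, congrArg nodes ?_, ?_, ?_⟩
  · simp [Term.cospan]
  · simp [Term.cospan]
  · exact he ▸ injective_sumElim_of_disjoint hφ hψ hAB
  · exact (congrArg Set.range he).trans (Set.Sum.elim_range _ _)

theorem Traced.tensor {A B : Set G.Edge} {F F' K K' : List G.Node} (h : Traced A F F')
    (h' : Traced B K K') (hAB : Disjoint A B) : Traced (A ∪ B) (F ++ K) (F' ++ K') := by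
  obtain ⟨w, v, t, φ, rfl, rfl, hφ, rfl⟩ := h
  obtain ⟨w', v', t', ψ, rfl, rfl, hψ, rfl⟩ := h'
  refine ⟨_, _, .tensor t t', desc φ ψ, ?_, ?_, injective_sumElim_of_disjoint hφ hψ hAB,
    Set.Sum.elim_range _ _⟩
  · rw [← nodes_discDesc]
    exact congrArg nodes (by simp [Term.cospan, Cospan.discDesc_comp])
  · rw [← nodes_discDesc]
    exact congrArg nodes (by simp [Term.cospan, Cospan.discDesc_comp])

/-- The generators of `List.Perm` match term constructors: `cons` is tensoring with an identity,
`swap` a symmetry tensored with an identity, `trans` composition. -/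
theorem Traced.perm {F F' : List G.Node} (h : F.Perm F') : Traced ∅ F F' := by
  induction h with
  | nil => exact .id _
  | cons z _ ih => simpa using (Traced.id [z]).tensor ih (Set.disjoint_empty _)
  | swap z z' K =>
    simpa using (Traced.symm [z'] [z]).tensor (Traced.id K) (Set.disjoint_empty _)
  | trans _ _ ih ih' => simpa using ih.comp ih' (Set.disjoint_empty _)

/-- Sources and targets of `e` may repeat in `G`; this is harmless, since `Traced` asks for
injectivity on hyperedges only. -/
theorem Traced.edge (e : G.Edge) : Traced {e} (G.src e) (G.tgt e) := by
  obtain ⟨f, hf⟩ := exists_nodes_eq (G.label.src_edge e).symm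
  obtain ⟨g, hg⟩ := exists_nodes_eq (G.label.tgt_edge e).symm
  let φ : opGraph S (G.label.edge e) ⟶ G :=
    ⟨⟨Sum.elim f.node g.node, fun _ => e,
      fun _ => hf.symm.trans (List.ofFn_eq_map.trans
        (List.map_map (f := Sum.inl) (g := Sum.elim f.node g.node)).symm),
      fun _ => hg.symm.trans (List.ofFn_eq_map.trans
        (List.map_map (f := Sum.inr) (g := Sum.elim f.node g.node)).symm)⟩,
      by rintro (i | i); exacts [f.label_node i, g.label_node i], fun _ => rfl⟩
  exact ⟨_, _, .op (G.label.edge e), φ, hf, hg, fun _ _ _ => rfl, Set.range_const (ι := Unit)⟩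

/-- Induction along the sorted list `L` of remaining hyperedges, with frontier `F`. The invariant is
that `F` with the remaining targets is repetition-free and is a permutation of `R` with the
remaining sources. -/
theorem Traced.of_topological_sort (R : List G.Node) :
    ∀ (L : List G.Edge) (F : List G.Node), L.Nodup →
      L.Pairwise (fun e e' => ¬ G.IsSuccessor e' e) → (∀ e, ¬ G.IsSuccessor e e) →
      (F ++ L.flatMap G.tgt).Nodup →
      (F ++ L.flatMap G.tgt).Perm (R ++ L.flatMap G.src) → Traced {e | e ∈ L} F R
  | [], F, _, _, _, _, hp => by simpa using Traced.perm (by simpa using hp)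
  | e :: L, F, hL, hs, hirr, hn, hp => by
    classical
    rw [List.pairwise_cons] at hs
    rw [List.nodup_cons] at hL
    simp only [List.flatMap_cons] at hn hp
    -- By the invariant a source of `e` is on the frontier or a remaining target. Irreflexivity
    -- excludes the targets of `e`, the sorting those of later hyperedges.
    have hsub : G.src e ⊆ F := by
      intro z hz
      have hz' : z ∈ F ++ (G.tgt e ++ L.flatMap G.tgt) := hp.mem_iff.2 (by simp [hz])
      rw [List.mem_append, List.mem_append, List.mem_flatMap] at hz'
      obtain hz' | hz' | ⟨e', he', hz'⟩ := hz'
      · exact hz'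
      · exact absurd ⟨z, hz', hz⟩ (hirr e)
      · exact absurd ⟨z, hz', hz⟩ (hs.1 e' he')
    have hnd : (G.src e).Nodup := by
      have := hp.nodup_iff.1 hn
      rw [List.nodup_append', List.nodup_append'] at this
      exact this.2.1.1
    -- `K` collects the wires that pass beside `e`. Splitting them off needs `src e` contained in
    -- `F` with multiplicity, hence `hnd`.
    obtain ⟨K, hK⟩ : ∃ K, F.Perm (G.src e ++ K) :=
      ⟨F.diff (G.src e), (List.subperm_append_diff_self_of_count_le
        (List.subperm_ext_iff.1 (hnd.subperm hsub))).symm⟩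
    -- The invariant for the new frontier: `src e` cancels from both sides.
    have hp' : ((G.tgt e ++ K) ++ L.flatMap G.tgt).Perm (R ++ L.flatMap G.src) := by
      refine List.perm_iff_count.2 fun z => ?_
      have h₁ := hp.count_eq z
      have h₂ := hK.count_eq z
      simp only [List.count_append] at h₁ h₂ ⊢
      omega
    have hn' : ((G.tgt e ++ K) ++ L.flatMap G.tgt).Nodup := by
      refine List.Nodup.of_append_right (l₁ := G.src e) ((List.Perm.nodup_iff ?_).1 hn)
      refine List.perm_iff_count.2 fun z => ?_
      have h₂ := hK.count_eq z
      simp only [List.count_append] at h₂ ⊢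
      omega
    have ih := Traced.of_topological_sort R L (G.tgt e ++ K) hL.2 hs.2 hirr hn' hp'
    have h := ((Traced.perm hK).comp ((Traced.edge e).tensor (.id K) (Set.disjoint_empty _))
      (Set.empty_disjoint _)).comp ih (by simpa using hL.1)
    convert h using 1
    ext e'
    simp

end LHyp

/-! ### From linear acyclic cospans to terms. -/

theorem Cospan.exists_term_of_linear {C : Type u} {S : Signature.{u, v} C} {a b : List C}
    {s : Cospan S a b} (h : s.Linear) (hs : s.Acyclic) :
    ∃ t : Term S a b, setoid S a b t.cospan s := by
  have := h.finite_edge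
  obtain ⟨L, hL, hmem, hsort⟩ := DirHypergraph.Acyclic.exists_topological_sort hs
  have hn := h.1.nodup_append hL
  -- Each side lists every node of the carrier exactly once; this is the initial invariant of the
  -- sweep.
  have hp : (nodes s.left ++ L.flatMap s.carrier.tgt).Perm
      (nodes s.right ++ L.flatMap s.carrier.src) :=
    (List.perm_ext_iff_of_nodup hn (h.2.nodup_append hL)).2
      fun z => iff_of_true (h.1.mem_append hmem z) (h.2.mem_append hmem z)
  obtain ⟨w, v, t, φ, hl, hr, hφ, hrange⟩ := Traced.of_topological_sort (nodes s.right) L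
    (nodes s.left) hL hsort (fun e he => hs.irreflexive_transGen e (.single he)) hn hp
  obtain rfl : w = a := by rw [← map_label_nodes (t.cospan.left ≫ φ), hl, map_label_nodes]
  obtain rfl : v = b := by rw [← map_label_nodes (t.cospan.right ≫ φ), hr, map_label_nodes]
  refine ⟨t, t.linear_cospan.equiv_of_hom h φ (nodes_injective hl) (nodes_injective hr)
    ⟨hφ, Set.range_eq_univ.1 ?_⟩⟩
  rw [hrange]
  exact Set.eq_univ_of_forall hmem

end StringDiagram

theorem mainTheorem9 {C : Type*} (S : StringDiagram.Signature C) (w v : List C)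
    (G : StringDiagram.Cospan S w v) :
    (∃ t : (StringDiagram.Syn S).Hom w v, (StringDiagram.interpretation S).map t = G.toHom) ↔
      G.Monogamous ∧ G.Acyclic := by
  rw [StringDiagram.exists_interpretation_eq_iff, StringDiagram.Cospan.monogamous_iff_linear]
  constructor
  · rintro ⟨t, ht⟩
    exact ⟨t.linear_cospan.of_equiv ht, (t.ranked_cospan.of_equiv ht).acyclic⟩
  · rintro ⟨h, hG⟩
    exact StringDiagram.Cospan.exists_term_of_linear h hG
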